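/- **Setting.** Let $l\ge 1$ and consider the AR system $$y(t)+\sum_{i=1}^{l}A_i y(t-i)=\sum_{i=0}^{l}B_{ui}u(t-i)+\sum_{i=0}^{l}B_{wi}w(t-i)+B_{d0}d(t),$$ with $y(t)\in\mathbb R^p$, $u(t)\in\mathbb R^m$, $w(t)\in\mathbb R^{m_w}$, $d(t)\in\mathbb R^{m_d}$ and $B_{d0}$ of full column rank. Put $\chi(t)=\mathrm{col}(y(t-1),\dots,y(t-l),u(t-1),\dots,u(t-l),w(t-1),\dots,w(t-l))$, and let $J_A,J_B,J_{B_1}$ be the constant $0/1$ matrices for which every trajectory satisfies $\chi(t+1)=\mathrm{col}\big(y(t),\,J_A\chi(t)+J_Bu(t)+J_{B_1}w(t)\big)$. Let a trajectory of the system be recorded, with data matrices $Y=(y(0)\cdots y(N-1))$, $X=(\chi(0)\cdots\chi(N-1))$, $U_{\rm dat}=(u(0)\cdots u(N-1))$, $W=(w(0)\cdots w(N-1))$, and let $W_d=(d(0)\cdots d(N-1))$. Let $X=X_s\Sigma_\chi X_r^\top$ be a compact singular value decomposition with $\tilde n=\operatorname{rank}X$ columns in $X_s$, let $X_d=\Sigma_\chi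 X_r^\top$, and let $X_s=\mathrm{col}(X_{s1},X_{s2})$ where $X_{s1}$ has $p$ rows. Let $\Phi=\Phi^\top=\begin{pmatrix}\Phi_{11}&\Phi_{12}\\ \Phi_{12}^\top&\Phi_{22}\end{pmatrix}\in\mathbb R^{(m_d+N)\times(m_d+N)}$ with $\Phi_{22}\prec0$, and let $$\Sigma=\Big\{(\bar A_s,B_{u0},B_{w0}) : Y=\bar A_sX_d+B_{u0}U_{\rm dat}+B_{w0}W+B_{d0}\Omega\ \text{ for some }\Omega\text{ with }\begin{pmatrix}I\\ \Omega^\top\end{pmatrix}^{\!\top}\!\Phi\begin{pmatrix}I\\ \Omega^\top\end{pmatrix}\succeq0\Big\}.$$ Assume: 1. starting from the recorded past, $\chi(t)\in\operatorname{im}X$ for all $t\ge 0$ and all inputs $u,w,d$; 2. the first $p$ rows of $X$ are linearly independent; 3. $\Omega=W_d$ satisfies the inequality in the definition of $\Sigma$; 4. $\Sigma\neq\emptyset$ and $\operatorname{rank}\mathrm{col}(X_d,U_{\rm dat},W)=\tilde n+m+m_w$. For a triple in $\Sigma$ let $A=X_s^\top\mathrm{col}(\bar A_s,J_AX_s)$,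 $B=X_s^\top\mathrm{col}(B_{u0},J_B)$, $B_1=X_s^\top\mathrm{col}(B_{w0},J_{B_1})$. Let $z=\hat C_1\chi+Eu+D_1w\in\mathbb R^{p_z}$, $y_c=\hat C\chi$, $C_1=\hat C_1X_s$, $C=\hat CX_s$. For a controller $x_c(t+1)=A_cx_c(t)+B_cy_c(t)$, $u(t)=C_cx_c(t)+D_cy_c(t)$ with $x_c(t)\in\mathbb R^{\tilde n}$ let $$\tilde A=\begin{pmatrix}A+BD_cC&BC_c\\B_cC&A_c\end{pmatrix},\quad \tilde B=\begin{pmatrix}B_1\\0\end{pmatrix},\quad \tilde C=\begin{pmatrix}C_1+ED_cC&EC_c\end{pmatrix},\quad \tilde D=D_1 .$$ Let $Q=Q^\top$, $S$ and $R\succeq0$ be given, with $R=T\tilde RT^\top$, $\tilde R\in\mathbb R^{\tilde p_z\times\tilde p_z}$, $\tilde R\succ0$. Let $$H=F\Phi F^\top,\qquad F=\begin{pmatrix}B_{d0}&Y\\0&-G\end{pmatrix},\qquad G=\mathrm{col}(X_d,U_{\rm dat},W),$$ partitioned into blocks $H_{ij}$, $i,j=1,\dots,4$, of sizes $p,\tilde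 n,m,m_w$; put $\mathcal H=(H_{ij})_{i,j\ge2}$, $\mathcal H_1=\mathrm{col}(H_{12}^\top,H_{13}^\top,H_{14}^\top)$, and $$(\check A_s\ \check B_{u0}\ \check B_{w0})^\top=-\mathcal H^{-1}\mathcal H_1,\qquad \bar{\mathcal H}=\mathcal H_1+\mathcal H(\check A_s\ \check B_{u0}\ \check B_{w0})^\top .$$ Let $\check A,\check B,\check B_1$ be $A,B,B_1$ evaluated at $(\check A_s,\check B_{u0},\check B_{w0})$. Let $\Lambda\in\mathbb R^{\tilde p\times\tilde p}$, $\Lambda\succ0$, and $\Xi$ satisfy $(I\ \check A_s\ \check B_{u0}\ \check B_{w0})H(I\ \check A_s\ \check B_{u0}\ \check B_{w0})^\top=\Xi\Lambda\Xi^\top$. Let $L=\mathrm{col}(L_1,L_2)$, where the columns of $L_1^\top$ form a basis of $\ker X_{s1}$ and $L_2=(X_{s1}X_{s1}^\top)^{-1}X_{s1}$. For a scalar $\alpha$, symmetric $\bar X,\bar Y\in\mathbb R^{\tilde n\times\tilde n}$ and matrices $\tilde A_c,\tilde B_c,\tilde C_c,D_c$ let $\Pi=\begin{pmatrix}\Pi_{11}&\Pi_{12}\\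 \Pi_{12}^\top&\Pi_{22}\end{pmatrix}$, where ($\star$ denotes blocks determined by symmetry) $$\Pi_{11}=\begin{pmatrix}\bar X&I&\star&\star\\ I&\bar Y&\star&\star\\ -S(C_1+ED_cC)&-S(C_1\bar Y+E\tilde C_c)&-Q-SD_1-(SD_1)^\top&\star\\ T^\top(C_1+ED_cC)&T^\top(C_1\bar Y+E\tilde C_c)&T^\top D_1&\tilde R^{-1}\end{pmatrix},$$ $$\Pi_{12}^\top=\begin{pmatrix}\check A+\check BD_cC&\check A\bar Y+\check B\tilde C_c&\check B_1&0\\ \bar X\check A+\tilde B_cC&\tilde A_c&\bar X\check B_1&0\\ I&\bar Y&0&0\\ D_cC&\tilde C_c&0&0\\ 0&0&I&0\\ 0_{\tilde p\times\tilde n}&0&0&0\end{pmatrix},$$ $$\Pi_{22}=\begin{pmatrix}\bar Y&I&\star&\star\\ I&\bar X&\star&\star\\ (0\ \ {-\alpha}\bar{\mathcal H})L^{-\top}&(0\ \ {-\alpha}\bar{\mathcal H})L^{-\top}\bar X&-\alpha\mathcal H&\star\\ (0\ \ \alpha\Xi^\top)L^{-\top}&(0\ \ \alpha\Xi^\top)L^{-\top}\bar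 X&0&\alpha\Lambda^{-1}\end{pmatrix}$$ (the third block row of $\Pi_{22}$ collects the rows of sizes $\tilde n,m,m_w$). **Theorem.** The following two statements are equivalent. (i) There are controller matrices $A_c,B_c,C_c,D_c$ and a matrix $P\succ0$ such that for all $(\bar A_s,B_{u0},B_{w0})\in\Sigma$ $$\begin{pmatrix}I&0\\ \tilde A&\tilde B\\0&I\\ \tilde C&\tilde D\end{pmatrix}^{\!\top}\begin{pmatrix}-P&0&0&0\\0&P&0&0\\0&0&Q&S\\0&0&S^\top&R\end{pmatrix}\begin{pmatrix}I&0\\ \tilde A&\tilde B\\0&I\\ \tilde C&\tilde D\end{pmatrix}\prec0 .$$ (ii) $\Pi\succ0$ for some real $\alpha$, symmetric $\bar X,\bar Y$ and matrices $\tilde A_c,\tilde B_c,\tilde C_c,D_c$. Moreover, for every solution of $\Pi\succ0$ and every invertible $U\in\mathbb R^{\tilde n\times\tilde n}$, the matrix $V^\top=U^{-1}(I-\bar X\bar Y)$ is invertible, and the controller given by $D_c$ and $$B_c=U^{-1}(\tilde B_c-\bar X\check BD_c),\qquad C_c=(\tilde C_c-D_cC\bar Y)V^{-\top},$$ $$A_c=U^{-1}\big(\tilde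 A_c-\bar X(\check A\bar Y+\check B\tilde C_c)-UB_cC\bar Y\big)V^{-\top}$$ satisfies (i) with some $P\succ0$. -/

import Mathlib

open Matrix

namespace DDSynth

/-! ### Autoregressive model, trajectories and the extended state -/

/-- Coefficients of the AR model
`y(t) + ∑_{i=1}^l A_i y(t-i) = ∑_{i=0}^l Bu_i u(t-i) + ∑_{i=0}^l Bw_i w(t-i) + Bd0 d(t)`.
For lag `l` only the entries `A 1, …, A l`, `Bu 0, …, Bu l`, `Bw 0, …, Bw l` are used. -/
structure ARModel (p m q md : ℕ) where
  A : ℕ → Matrix (Fin p) (Fin p) ℝ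
  Bu : ℕ → Matrix (Fin p) (Fin m) ℝ
  Bw : ℕ → Matrix (Fin p) (Fin q) ℝ
  Bd0 : Matrix (Fin p) (Fin md) ℝ

/-- The signals: output `y`, control input `u`, disturbance `w` of the performance channel,
noise `d`. -/
structure Signals (p m q md : ℕ) where
  y : ℤ → Fin p → ℝ
  u : ℤ → Fin m → ℝ
  w : ℤ → Fin q → ℝ
  d : ℤ → Fin md → ℝ

/-- The AR equation with lag `l` holds at time `t`. -/
def ARModel.HoldsAt {p m q md : ℕ} (M : ARModel p m q md) (l : ℕ) (s : Signals p m q md)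
    (t : ℤ) : Prop :=
  s.y t + ∑ i ∈ Finset.Icc 1 l, M.A i *ᵥ s.y (t - i) =
    (∑ i ∈ Finset.range (l + 1), M.Bu i *ᵥ s.u (t - i)) +
    (∑ i ∈ Finset.range (l + 1), M.Bw i *ᵥ s.w (t - i)) + M.Bd0 *ᵥ s.d t

/-- Coordinates of the extended state below the first `p` ones:
`y(t-2), …, y(t-l)`, then `u(t-1), …, u(t-l)`, then `w(t-1), …, w(t-l)`. -/
abbrev RestIdx (l p m q : ℕ) : Type :=
  (Fin (l - 1) × Fin p) ⊕ ((Fin l × Fin m) ⊕ (Fin l × Fin q))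

/-- Coordinates of the extended state
`χ(t) = col(y(t-1), …, y(t-l), u(t-1), …, u(t-l), w(t-1), …, w(t-l))`;
the first summand is `y(t-1)`. -/
abbrev StateIdx (l p m q : ℕ) : Type := Fin p ⊕ RestIdx l p m q

/-- The delay of the signal sample stored in a coordinate of the extended state. -/
def delay {l p m q : ℕ} : StateIdx l p m q → ℕ
  | .inl _ => 1
  | .inr (.inl (i, _)) => i + 2
  | .inr (.inr (.inl (i, _))) => i + 1
  | .inr (.inr (.inr (i, _))) => i + 1

/-- The scalar channel (component of `y`, of `u` or of `w`) stored in a coordinate of the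
extended state. -/
def channel {l p m q : ℕ} : StateIdx l p m q → Fin p ⊕ (Fin m ⊕ Fin q)
  | .inl a => .inl a
  | .inr (.inl (_, a)) => .inl a
  | .inr (.inr (.inl (_, b))) => .inr (.inl b)
  | .inr (.inr (.inr (_, c))) => .inr (.inr c)

/-- The extended state `χ(t)`. -/
def stateVec {p m q md : ℕ} (l : ℕ) (s : Signals p m q md) (t : ℤ) : StateIdx l p m q → ℝ :=
  fun k => Sum.elim (s.y (t - delay k)) (Sum.elim (s.u (t - delay k)) (s.w (t - delay k)))
    (channel k)

/-- `J_A`: the known shift part of the state matrix. -/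
def JA (l p m q : ℕ) : Matrix (RestIdx l p m q) (StateIdx l p m q) ℝ :=
  Matrix.of fun r c =>
    if channel (.inr r : StateIdx l p m q) = channel c ∧
        delay (.inr r : StateIdx l p m q) = delay c + 1 then 1 else 0

/-- `J_B`: the input `u(t)` enters the coordinates that store `u` with delay one. -/
def JB (l p m q : ℕ) : Matrix (RestIdx l p m q) (Fin m) ℝ :=
  Matrix.of fun r b =>
    if channel (.inr r : StateIdx l p m q) = .inr (.inl b) ∧
        delay (.inr r : StateIdx l p m q) = 1 then 1 else 0

/-- `J_{B_1}`: the input `w(t)` enters the coordinates that store `w` with delay one. -/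
def JB1 (l p m q : ℕ) : Matrix (RestIdx l p m q) (Fin q) ℝ :=
  Matrix.of fun r c =>
    if channel (.inr r : StateIdx l p m q) = .inr (.inr c) ∧
        delay (.inr r : StateIdx l p m q) = 1 then 1 else 0

/-! ### Recorded data -/

/-- `Y = (y(0) … y(N-1))`. -/
def dataY {p m q md : ℕ} (N : ℕ) (s : Signals p m q md) : Matrix (Fin p) (Fin N) ℝ :=
  Matrix.of fun a t => s.y (t : ℕ) a

/-- `X = (χ(0) … χ(N-1))`. -/
def dataX {p m q md : ℕ} (l N : ℕ) (s : Signals p m q md) :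
    Matrix (StateIdx l p m q) (Fin N) ℝ :=
  Matrix.of fun k t => stateVec l s (t : ℕ) k

/-- `U = (u(0) … u(N-1))`. -/
def dataU {p m q md : ℕ} (N : ℕ) (s : Signals p m q md) : Matrix (Fin m) (Fin N) ℝ :=
  Matrix.of fun b t => s.u (t : ℕ) b

/-- `W = (w(0) … w(N-1))`. -/
def dataW {p m q md : ℕ} (N : ℕ) (s : Signals p m q md) : Matrix (Fin q) (Fin N) ℝ :=
  Matrix.of fun c t => s.w (t : ℕ) c

/-- `W_d = (d(0) … d(N-1))`. -/
def dataD {p m q md : ℕ} (N : ℕ) (s : Signals p m q md) : Matrix (Fin md) (Fin N) ℝ :=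
  Matrix.of fun c t => s.d (t : ℕ) c

/-- Whatever inputs `u, w, d` are applied from time `0` on, starting from the recorded past,
the extended state never leaves the column space of the recorded state data matrix. -/
def StateStaysInData {p m q md : ℕ} (M : ARModel p m q md) (l N : ℕ)
    (s : Signals p m q md) : Prop :=
  ∀ s' : Signals p m q md,
    (∀ t : ℤ, t < 0 → s'.y t = s.y t ∧ s'.u t = s.u t ∧ s'.w t = s.w t) →
    (∀ t : ℤ, 0 ≤ t → M.HoldsAt l s' t) →
    ∀ t : ℤ, 0 ≤ t → stateVec l s' t ∈ LinearMap.range (dataX l N s).mulVecLin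

/-- `X = X_s diag(σ) X_rᵀ` is a compact singular value decomposition. -/
def IsCompactSVD {ι : Type*} [Fintype ι] [DecidableEq ι] {N n : ℕ} (X : Matrix ι (Fin N) ℝ)
    (Xs : Matrix ι (Fin n) ℝ) (σ : Fin n → ℝ) (Xr : Matrix (Fin N) (Fin n) ℝ) : Prop :=
  Xsᵀ * Xs = 1 ∧ Xrᵀ * Xr = 1 ∧ (∀ i, 0 < σ i) ∧ X = Xs * Matrix.diagonal σ * Xrᵀ

/-- The quadratic matrix inequality bounding the noise data. -/
def NoiseBound {md N : ℕ} (Φ : Matrix (Fin md ⊕ Fin N) (Fin md ⊕ Fin N) ℝ)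
    (Wd : Matrix (Fin md) (Fin N) ℝ) : Prop :=
  ((fromRows (1 : Matrix (Fin md) (Fin md) ℝ) Wdᵀ)ᵀ * Φ *
    fromRows (1 : Matrix (Fin md) (Fin md) ℝ) Wdᵀ).PosSemidef

/-- The set `Σ` of triples `(Ā_s, B_{u0}, B_{w0})` consistent with the data. -/
def consistentSet {p m q md N n : ℕ} (Bd0 : Matrix (Fin p) (Fin md) ℝ)
    (Φ : Matrix (Fin md ⊕ Fin N) (Fin md ⊕ Fin N) ℝ)
    (Y : Matrix (Fin p) (Fin N) ℝ) (Xd : Matrix (Fin n) (Fin N) ℝ)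
    (U : Matrix (Fin m) (Fin N) ℝ) (W : Matrix (Fin q) (Fin N) ℝ) :
    Set (Matrix (Fin p) (Fin n) ℝ × Matrix (Fin p) (Fin m) ℝ × Matrix (Fin p) (Fin q) ℝ) :=
  {τ | ∃ Wd : Matrix (Fin md) (Fin N) ℝ, NoiseBound Φ Wd ∧
    Y = τ.1 * Xd + τ.2.1 * U + τ.2.2 * W + Bd0 * Wd}

/-! ### Reduced realization and closed loop -/

/-- `A = X_sᵀ col(Ā_s, J_A X_s)`. -/
def redA {l p m q n : ℕ} (Xs : Matrix (StateIdx l p m q) (Fin n) ℝ)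
    (As : Matrix (Fin p) (Fin n) ℝ) : Matrix (Fin n) (Fin n) ℝ :=
  Xsᵀ * fromRows As (JA l p m q * Xs)

/-- `B = X_sᵀ col(B_{u0}, J_B)`. -/
def redB {l p m q n : ℕ} (Xs : Matrix (StateIdx l p m q) (Fin n) ℝ)
    (Bu0 : Matrix (Fin p) (Fin m) ℝ) : Matrix (Fin n) (Fin m) ℝ :=
  Xsᵀ * fromRows Bu0 (JB l p m q)

/-- `B_1 = X_sᵀ col(B_{w0}, J_{B_1})`. -/
def redB1 {l p m q n : ℕ} (Xs : Matrix (StateIdx l p m q) (Fin n) ℝ)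
    (Bw0 : Matrix (Fin p) (Fin q) ℝ) : Matrix (Fin n) (Fin q) ℝ :=
  Xsᵀ * fromRows Bw0 (JB1 l p m q)

/-- The outer factor with block rows `(I 0)`, `(A B)`, `(0 I)`, `(C D)`. -/
def dissOuter {ι : Type*} [DecidableEq ι] {q pz : ℕ}
    (A : Matrix ι ι ℝ) (B : Matrix ι (Fin q) ℝ) (C : Matrix (Fin pz) ι ℝ)
    (D : Matrix (Fin pz) (Fin q) ℝ) :
    Matrix ((ι ⊕ ι) ⊕ (Fin q ⊕ Fin pz)) (ι ⊕ Fin q) ℝ :=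
  fromRows (fromBlocks 1 0 A B) (fromBlocks 0 1 C D)

/-- The strict dissipation inequality of the system `(A, B, C, D)` with storage matrix `P` for
the supply function with matrix `-(Q S; Sᵀ R)`. -/
def DissipationIneq {ι : Type*} [Fintype ι] [DecidableEq ι] {q pz : ℕ}
    (A : Matrix ι ι ℝ) (B : Matrix ι (Fin q) ℝ) (C : Matrix (Fin pz) ι ℝ)
    (D : Matrix (Fin pz) (Fin q) ℝ) (Q : Matrix (Fin q) (Fin q) ℝ)
    (S : Matrix (Fin q) (Fin pz) ℝ) (R : Matrix (Fin pz) (Fin pz) ℝ)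
    (P : Matrix ι ι ℝ) : Prop :=
  (-((dissOuter A B C D)ᵀ *
      fromBlocks (fromBlocks (-P) 0 0 P) 0 0 (fromBlocks Q S Sᵀ R) *
      dissOuter A B C D)).PosDef

/-- The controller `(Ac, Bc, Cc, Dc)` and the certificate `P` satisfy `P ≻ 0` and the strict
dissipation inequality of the closed loop for every triple in the set `Sig`. -/
def RobustDissipative {l p m q n pc pz : ℕ} (Xs : Matrix (StateIdx l p m q) (Fin n) ℝ)
    (Sig : Set (Matrix (Fin p) (Fin n) ℝ × Matrix (Fin p) (Fin m) ℝ × Matrix (Fin p) (Fin q) ℝ))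
    (C : Matrix (Fin pc) (Fin n) ℝ) (C1 : Matrix (Fin pz) (Fin n) ℝ)
    (E : Matrix (Fin pz) (Fin m) ℝ) (D1 : Matrix (Fin pz) (Fin q) ℝ)
    (Q : Matrix (Fin q) (Fin q) ℝ) (S : Matrix (Fin q) (Fin pz) ℝ)
    (R : Matrix (Fin pz) (Fin pz) ℝ)
    (Ac : Matrix (Fin n) (Fin n) ℝ) (Bc : Matrix (Fin n) (Fin pc) ℝ)
    (Cc : Matrix (Fin m) (Fin n) ℝ) (Dc : Matrix (Fin m) (Fin pc) ℝ)
    (P : Matrix (Fin n ⊕ Fin n) (Fin n ⊕ Fin n) ℝ) : Prop :=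
  P.PosDef ∧ ∀ τ ∈ Sig,
    DissipationIneq
      (fromBlocks (redA Xs τ.1 + redB Xs τ.2.1 * Dc * C) (redB Xs τ.2.1 * Cc) (Bc * C) Ac)
      (fromRows (redB1 Xs τ.2.2) 0)
      (fromCols (C1 + E * Dc * C) (E * Cc))
      D1 Q S R P

/-! ### Matrices of the synthesis inequality -/

/-- The matrix `H`, partitioned as `p + (n + m + q)`. -/
def matH {p m q md N n : ℕ} (Bd0 : Matrix (Fin p) (Fin md) ℝ)
    (Φ : Matrix (Fin md ⊕ Fin N) (Fin md ⊕ Fin N) ℝ)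
    (Y : Matrix (Fin p) (Fin N) ℝ) (Xd : Matrix (Fin n) (Fin N) ℝ)
    (U : Matrix (Fin m) (Fin N) ℝ) (W : Matrix (Fin q) (Fin N) ℝ) :
    Matrix (Fin p ⊕ (Fin n ⊕ (Fin m ⊕ Fin q))) (Fin p ⊕ (Fin n ⊕ (Fin m ⊕ Fin q))) ℝ :=
  fromBlocks Bd0 Y 0 (-fromRows Xd (fromRows U W)) * Φ *
    (fromBlocks Bd0 Y 0 (-fromRows Xd (fromRows U W)))ᵀ

/-- `(Ǎ_s  B̌_{u0}  B̌_{w0})ᵀ`: minus the inverse of the lower right block of `H` times the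
lower left block of `H`. -/
noncomputable def centerT {p : ℕ} {κ : Type*} [Fintype κ] [DecidableEq κ]
    (H : Matrix (Fin p ⊕ κ) (Fin p ⊕ κ) ℝ) : Matrix κ (Fin p) ℝ :=
  -(H.toBlocks₂₂⁻¹ * H.toBlocks₂₁)

/-- `col(I, Ǎ_sᵀ, B̌_{u0}ᵀ, B̌_{w0}ᵀ)`. -/
noncomputable def colCenter {p : ℕ} {κ : Type*} [Fintype κ] [DecidableEq κ]
    (H : Matrix (Fin p ⊕ κ) (Fin p ⊕ κ) ℝ) : Matrix (Fin p ⊕ κ) (Fin p) ℝ :=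
  fromRows 1 (centerT H)

/-- `Ǎ_s`. -/
noncomputable def checkAs {p m q n : ℕ}
    (H : Matrix (Fin p ⊕ (Fin n ⊕ (Fin m ⊕ Fin q))) (Fin p ⊕ (Fin n ⊕ (Fin m ⊕ Fin q))) ℝ) :
    Matrix (Fin p) (Fin n) ℝ :=
  (centerT H)ᵀ.toCols₁

/-- `B̌_{u0}`. -/
noncomputable def checkBu0 {p m q n : ℕ}
    (H : Matrix (Fin p ⊕ (Fin n ⊕ (Fin m ⊕ Fin q))) (Fin p ⊕ (Fin n ⊕ (Fin m ⊕ Fin q))) ℝ) :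
    Matrix (Fin p) (Fin m) ℝ :=
  (centerT H)ᵀ.toCols₂.toCols₁

/-- `B̌_{w0}`. -/
noncomputable def checkBw0 {p m q n : ℕ}
    (H : Matrix (Fin p ⊕ (Fin n ⊕ (Fin m ⊕ Fin q))) (Fin p ⊕ (Fin n ⊕ (Fin m ⊕ Fin q))) ℝ) :
    Matrix (Fin p) (Fin q) ℝ :=
  (centerT H)ᵀ.toCols₂.toCols₂

/-- `col(H̄₁₂ᵀ, H̄₁₃ᵀ, H̄₁₄ᵀ)`: the lower block rows of `H` times
`col(I, Ǎ_sᵀ, B̌_{u0}ᵀ, B̌_{w0}ᵀ)`. -/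
noncomputable def barHT {p : ℕ} {κ : Type*} [Fintype κ] [DecidableEq κ]
    (H : Matrix (Fin p ⊕ κ) (Fin p ⊕ κ) ℝ) : Matrix κ (Fin p) ℝ :=
  H.toRows₂ * colCenter H

/-- The two-sided inverse of a matrix whose rows and columns may be indexed by different types;
`0` if there is none. -/
noncomputable def rectInv {ι κ : Type*} [Fintype ι] [Fintype κ] [DecidableEq ι] [DecidableEq κ]
    (L : Matrix ι κ ℝ) : Matrix κ ι ℝ :=
  open Classical in if h : ∃ K : Matrix κ ι ℝ, L * K = 1 ∧ K * L = 1 then h.choose else 0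

theorem rectInv_eq {ι κ : Type*} [Fintype ι] [Fintype κ] [DecidableEq ι] [DecidableEq κ]
    {L : Matrix ι κ ℝ} {K : Matrix κ ι ℝ} (h1 : L * K = 1) (h2 : K * L = 1) :
    rectInv L = K := by
  have h : ∃ K : Matrix κ ι ℝ, L * K = 1 ∧ K * L = 1 := ⟨K, h1, h2⟩
  rw [rectInv, dif_pos h]
  calc h.choose = (K * L) * h.choose := by rw [h2, Matrix.one_mul]
    _ = K := by rw [Matrix.mul_assoc, h.choose_spec.1, Matrix.mul_one]

/-- The rows of `L1` form a basis of the kernel of `X`. -/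
def RowsBasisOfKer {r p n : ℕ} (L1 : Matrix (Fin r) (Fin n) ℝ)
    (X : Matrix (Fin p) (Fin n) ℝ) : Prop :=
  LinearIndependent ℝ L1.row ∧
    Submodule.span ℝ (Set.range L1.row) = LinearMap.ker X.mulVecLin

/-- `L = col(L_1, L_2)` with `L_2 = (X_{s1} X_{s1}ᵀ)⁻¹ X_{s1}`. -/
noncomputable def matL {r p n : ℕ} (L1 : Matrix (Fin r) (Fin n) ℝ)
    (Xs1 : Matrix (Fin p) (Fin n) ℝ) : Matrix (Fin r ⊕ Fin p) (Fin n) ℝ :=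
  fromRows L1 ((Xs1 * Xs1ᵀ)⁻¹ * Xs1)

/-- `Π₁₁`, with block rows `(n + n) + (q + p̃_z)`. -/
noncomputable def matPi11 {m q n pc pz pzt : ℕ}
    (C : Matrix (Fin pc) (Fin n) ℝ) (C1 : Matrix (Fin pz) (Fin n) ℝ)
    (E : Matrix (Fin pz) (Fin m) ℝ) (D1 : Matrix (Fin pz) (Fin q) ℝ)
    (Q : Matrix (Fin q) (Fin q) ℝ) (S : Matrix (Fin q) (Fin pz) ℝ)
    (T : Matrix (Fin pz) (Fin pzt) ℝ) (Rt : Matrix (Fin pzt) (Fin pzt) ℝ)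
    (X Y : Matrix (Fin n) (Fin n) ℝ) (Cct : Matrix (Fin m) (Fin n) ℝ)
    (Dc : Matrix (Fin m) (Fin pc) ℝ) :
    Matrix ((Fin n ⊕ Fin n) ⊕ (Fin q ⊕ Fin pzt)) ((Fin n ⊕ Fin n) ⊕ (Fin q ⊕ Fin pzt)) ℝ :=
  let G := fromBlocks
    (-(S * (C1 + E * Dc * C))) (-(S * (C1 * Y + E * Cct)))
    (Tᵀ * (C1 + E * Dc * C)) (Tᵀ * (C1 * Y + E * Cct))
  fromBlocks
    (fromBlocks X 1 1 Y) Gᵀ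
    G (fromBlocks (-Q - ((S * D1)ᵀ + S * D1)) (Tᵀ * D1)ᵀ (Tᵀ * D1) Rt⁻¹)

/-- `Π₁₂ᵀ`, with block rows `(n + n) + ((n + m + q) + p̃)` and block columns
`(n + n) + (q + p̃_z)`. -/
def matPi12T {m q n pc : ℕ} (pzt pt : ℕ)
    (C : Matrix (Fin pc) (Fin n) ℝ)
    (Ach : Matrix (Fin n) (Fin n) ℝ) (Bch : Matrix (Fin n) (Fin m) ℝ)
    (B1ch : Matrix (Fin n) (Fin q) ℝ)
    (X Y Act : Matrix (Fin n) (Fin n) ℝ) (Bct : Matrix (Fin n) (Fin pc) ℝ)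
    (Cct : Matrix (Fin m) (Fin n) ℝ) (Dc : Matrix (Fin m) (Fin pc) ℝ) :
    Matrix ((Fin n ⊕ Fin n) ⊕ ((Fin n ⊕ (Fin m ⊕ Fin q)) ⊕ Fin pt))
      ((Fin n ⊕ Fin n) ⊕ (Fin q ⊕ Fin pzt)) ℝ :=
  fromBlocks
    (fromBlocks (Ach + Bch * Dc * C) (Ach * Y + Bch * Cct) (X * Ach + Bct * C) Act)
    (fromBlocks B1ch 0 (X * B1ch) 0)
    (fromRows
      (fromRows (fromCols 1 Y) (fromRows (fromCols (Dc * C) Cct) (fromCols 0 0)))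
      0)
    (fromRows
      (fromRows (fromCols 0 0) (fromRows (fromCols 0 0) (fromCols 1 0)))
      0)

/-- `Π₂₂`, with block rows `(n + n) + ((n + m + q) + p̃)`. -/
noncomputable def matPi22 {p m q n r pt : ℕ}
    (H : Matrix (Fin p ⊕ (Fin n ⊕ (Fin m ⊕ Fin q))) (Fin p ⊕ (Fin n ⊕ (Fin m ⊕ Fin q))) ℝ)
    (L : Matrix (Fin r ⊕ Fin p) (Fin n) ℝ)
    (Ξ : Matrix (Fin p) (Fin pt) ℝ) (Λ : Matrix (Fin pt) (Fin pt) ℝ)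
    (α : ℝ) (X Y : Matrix (Fin n) (Fin n) ℝ) :
    Matrix ((Fin n ⊕ Fin n) ⊕ ((Fin n ⊕ (Fin m ⊕ Fin q)) ⊕ Fin pt))
      ((Fin n ⊕ Fin n) ⊕ ((Fin n ⊕ (Fin m ⊕ Fin q)) ⊕ Fin pt)) ℝ :=
  let F := fromCols (0 : Matrix (Fin n ⊕ (Fin m ⊕ Fin q)) (Fin r) ℝ) (-(α • barHT H)) *
    (rectInv L)ᵀ
  let F' := fromCols (0 : Matrix (Fin pt) (Fin r) ℝ) (α • Ξᵀ) * (rectInv L)ᵀ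
  let G := fromBlocks F (F * X) F' (F' * X)
  fromBlocks
    (fromBlocks Y 1 1 X) Gᵀ
    G (fromBlocks (-(α • H.toBlocks₂₂)) 0 0 (α • Λ⁻¹))

/-- The synthesis matrix `Π`. -/
noncomputable def matPi {l p m q n r pc pz pzt pt : ℕ}
    (Xs : Matrix (StateIdx l p m q) (Fin n) ℝ)
    (H : Matrix (Fin p ⊕ (Fin n ⊕ (Fin m ⊕ Fin q))) (Fin p ⊕ (Fin n ⊕ (Fin m ⊕ Fin q))) ℝ)
    (L1 : Matrix (Fin r) (Fin n) ℝ)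
    (Ξ : Matrix (Fin p) (Fin pt) ℝ) (Λ : Matrix (Fin pt) (Fin pt) ℝ)
    (C : Matrix (Fin pc) (Fin n) ℝ) (C1 : Matrix (Fin pz) (Fin n) ℝ)
    (E : Matrix (Fin pz) (Fin m) ℝ) (D1 : Matrix (Fin pz) (Fin q) ℝ)
    (Q : Matrix (Fin q) (Fin q) ℝ) (S : Matrix (Fin q) (Fin pz) ℝ)
    (T : Matrix (Fin pz) (Fin pzt) ℝ) (Rt : Matrix (Fin pzt) (Fin pzt) ℝ)
    (α : ℝ) (X Y Act : Matrix (Fin n) (Fin n) ℝ) (Bct : Matrix (Fin n) (Fin pc) ℝ)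
    (Cct : Matrix (Fin m) (Fin n) ℝ) (Dc : Matrix (Fin m) (Fin pc) ℝ) :
    Matrix (((Fin n ⊕ Fin n) ⊕ (Fin q ⊕ Fin pzt)) ⊕
        ((Fin n ⊕ Fin n) ⊕ ((Fin n ⊕ (Fin m ⊕ Fin q)) ⊕ Fin pt)))
      (((Fin n ⊕ Fin n) ⊕ (Fin q ⊕ Fin pzt)) ⊕
        ((Fin n ⊕ Fin n) ⊕ ((Fin n ⊕ (Fin m ⊕ Fin q)) ⊕ Fin pt))) ℝ :=
  let PT := matPi12T pzt pt C (redA Xs (checkAs H)) (redB Xs (checkBu0 H))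
    (redB1 Xs (checkBw0 H)) X Y Act Bct Cct Dc
  fromBlocks
    (matPi11 C C1 E D1 Q S T Rt X Y Cct Dc) PTᵀ
    PT (matPi22 H (matL L1 Xs.toRows₁) Ξ Λ α X Y)

end DDSynth

/-! Statement (i) is a strict dissipation inequality over a set of plants cut out by a quadratic
matrix inequality. The proof reduces it without loss to a single matrix inequality with one
multiplier, then makes that inequality linear in transformed controller variables.

Data: a triple Z is consistent exactly when (I Z)H(I Z)ᵀ ⪰ 0 (`mem_consistentSet_iff`); full column
rank of B_d0 and Φ₂₂ ≺ 0 allow the noise matrix to be eliminated. The rank condition makes 𝓗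
negative definite, so completing the square around the center leaves ΞΛΞᵀ + Δ𝓗Δᵀ ⪰ 0 for the
deviation Δ, which enters the closed loop affinely through X_s1ᵀ.

Analysis, for a fixed controller and P: let c be the input of the uncertainty. Already rank-one
admissible Δ produce Δc = Ξf for every f with fᵀΛ⁻¹f ≤ cᵀ(-𝓗)⁻¹c (`exists_uncertainty`). Robust
dissipativity therefore makes one quadratic form positive wherever another is nonnegative, and
`strict_s_lemma` supplies a multiplier without any Slater condition. Undoing the completed squares
gives `analysisMat` ≻ 0. Conversely, suitable auxiliary vectors inserted in that form recover the
inequality for each Δ (`dissVal_pos_of_analysisMat_posDef`).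

Synthesis: congruence with the block triangular matrices (I Ȳ; 0 Vᵀ) and (I X̄; 0 Uᵀ) carries
`analysisMat` to Π (`matPi_eq_congr`). The terms in H̄ vanish and L⁻ᵀ merely reproduces X_s1. From
(ii) to (i), I - X̄Ȳ is invertible, so every invertible U gives a controller. From (i) to (ii), the
off-diagonal block P₁₂ must be invertible; strictness permits a small perturbation of P that
achieves this. -/

namespace DDSynth

/-! ### Quadratic functions and the strict S-lemma -/

section Quadratic

variable {E : Type*} [NormedAddCommGroup E] [NormedSpace ℝ E]

/-- A continuous function that restricts to a binary quadratic form on every pair of vectors. -/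
def IsQuadratic (g : E → ℝ) : Prop :=
  Continuous g ∧ ∃ B : E → E → ℝ, ∀ (a b : E) (s t : ℝ),
    g (s • a + t • b) = s ^ 2 * g a + s * t * B a b + t ^ 2 * g b

theorem IsQuadratic.smul {g : E → ℝ} (hg : IsQuadratic g) (c : ℝ) (a : E) :
    g (c • a) = c ^ 2 * g a := by
  obtain ⟨-, B, hB⟩ := hg
  simpa using hB a a c 0

theorem IsQuadratic.add_mul {g h : E → ℝ} (hg : IsQuadratic g) (hh : IsQuadratic h) (c : ℝ) :
    IsQuadratic (fun z => g z + c * h z) := by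
  obtain ⟨cg, B, hB⟩ := hg
  obtain ⟨ch, B', hB'⟩ := hh
  refine ⟨cg.add (continuous_const.mul ch), fun a b => B a b + c * B' a b, fun a b s t => ?_⟩
  simp only [hB, hB']
  ring

/-- A quadratic function takes the sign it has on the unit sphere. -/
theorem IsQuadratic.pos_of_sphere {g : E → ℝ} (hg : IsQuadratic g)
    (h : ∀ z : E, ‖z‖ = 1 → 0 < g z) {z : E} (hz : z ≠ 0) : 0 < g z := by
  have hn : 0 < ‖z‖ := norm_pos_iff.2 hz
  have h1 := h (‖z‖⁻¹ • z) (by rw [norm_smul, norm_inv, norm_norm, inv_mul_cancel₀ hn.ne'])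
  rw [hg.smul] at h1
  exact pos_of_mul_pos_right h1 (by positivity)

/-- If `h` is positive at `a` and negative at `b`, then `h` vanishes at some `a + t b` with `t` on
any prescribed side of `0`. -/
theorem IsQuadratic.exists_root {h : E → ℝ} (hh : IsQuadratic h) {a b : E} (ha : 0 < h a)
    (hb : h b < 0) (c : ℝ) : ∃ t : ℝ, t * c ≤ 0 ∧ h (a + t • b) = 0 := by
  have key : ∀ b : E, h b < 0 → ∃ t : ℝ, 0 ≤ t ∧ h (a + t • b) = 0 := by
    intro b hb
    obtain ⟨hcont, B, hB⟩ := hh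
    have e : ∀ t : ℝ, h (a + t • b) = h a + t * B a b + t ^ 2 * h b := fun t => by
      simpa using hB a b 1 t
    have hcf : Continuous fun t : ℝ => h (a + t • b) := by fun_prop
    -- This choice makes |B a b| + h a + T * h b equal to h b < 0, and T ≥ 1 lets T times it bound h
    -- (a + T • b) from above.
    set T : ℝ := (|B a b| + h a) / (-h b) + 1 with hT
    have hT1 : 1 ≤ T := by
      rw [hT]
      have : 0 ≤ (|B a b| + h a) / (-h b) := div_nonneg (by positivity) (by linarith)
      linarith
    have hT2 : (T - 1) * (-h b) = |B a b| + h a := by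
      rw [hT, add_sub_cancel_right, div_mul_cancel₀]
      linarith
    have hneg : h (a + T • b) ≤ 0 := by
      rw [e]
      have h1 : T * B a b ≤ T * |B a b| := mul_le_mul_of_nonneg_left (le_abs_self _) (by linarith)
      have h2 : h a ≤ T * h a := by nlinarith
      have h3 : T * (|B a b| + h a + T * h b) ≤ 0 :=
        mul_nonpos_of_nonneg_of_nonpos (by linarith) (by nlinarith)
      nlinarith
    obtain ⟨t, ht, h0⟩ := intermediate_value_Icc' (by linarith : (0 : ℝ) ≤ T) hcf.continuousOn
      (show (0 : ℝ) ∈ Set.Icc (h (a + T • b)) (h (a + (0 : ℝ) • b)) from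
        ⟨hneg, by simpa using ha.le⟩)
    exact ⟨t, ht.1, h0⟩
  rcases le_total c 0 with hc | hc
  · obtain ⟨t, ht, h0⟩ := key b hb
    exact ⟨t, mul_nonpos_of_nonneg_of_nonpos ht hc, h0⟩
  · obtain ⟨t, ht, h0⟩ := key (-b) (by
      have := hh.smul (-1) b
      simp only [neg_smul, one_smul] at this
      rw [this]; linarith)
    exact ⟨-t, by nlinarith, by simpa using h0⟩

/-- The two-vector core of the S-lemma. -/
theorem IsQuadratic.not_nonpos_pair {g h : E → ℝ} (hg : IsQuadratic g) (hh : IsQuadratic h)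
    (H : ∀ z, z ≠ 0 → 0 ≤ h z → 0 < g z) {α : ℝ} {a b : E} (ha : a ≠ 0) (hb : b ≠ 0)
    (ha' : g a ≤ α * h a) (hb' : g b ≤ α * h b) (h1 : 0 ≤ h a) (h2 : h b ≤ 0) : False := by
  have hga := H a ha h1
  have h1' : 0 < h a := lt_of_le_of_ne h1 fun h0 => by rw [← h0] at ha'; linarith
  have h2' : h b < 0 := lt_of_le_of_ne h2 fun h0 => by
    have := H b hb h0.ge
    rw [h0] at hb'; linarith
  obtain ⟨-, B, hB⟩ := hg.add_mul hh (-α)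
  -- The side of the root is chosen to make the cross term t * B a b of g - αh nonpositive. Then g -
  -- αh ≤ 0 at a + t • b, although h vanishes and g is positive there.
  obtain ⟨t, ht, h0⟩ := hh.exists_root h1' h2' (B a b)
  have hne : a + t • b ≠ 0 := by
    intro hz
    have hab : a = (-t) • b := by rw [neg_smul]; exact eq_neg_of_add_eq_zero_left hz
    have := hh.smul (-t) b
    rw [← hab] at this
    nlinarith [sq_nonneg t]
  have h3 := H _ hne h0.ge
  have h4 := hB a b 1 t
  simp only [one_smul, h0, mul_zero, add_zero] at h4
  have h5 : t ^ 2 * (g b + -α * h b) ≤ 0 :=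
    mul_nonpos_of_nonneg_of_nonpos (sq_nonneg t) (by linarith)
  nlinarith

variable [FiniteDimensional ℝ E]

/-- Small multiples of a quadratic function do not destroy positive definiteness. -/
theorem exists_perturbation {f k : E → ℝ} (hf : IsQuadratic f) (hk : IsQuadratic k)
    (hpos : ∀ z, z ≠ 0 → 0 < f z) :
    ∃ δ > 0, ∀ ε : ℝ, |ε| < δ → ∀ z, z ≠ 0 → 0 < f z + ε * k z := by
  have hc : IsCompact (Metric.sphere (0 : E) 1) := isCompact_sphere _ _
  rcases (Metric.sphere (0 : E) 1).eq_empty_or_nonempty with he | hne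
  · refine ⟨1, one_pos, fun ε _ z hz => (hf.add_mul hk ε).pos_of_sphere (fun y hy => ?_) hz⟩
    have : y ∈ Metric.sphere (0 : E) 1 := by simpa using hy
    simp [he] at this
  obtain ⟨z₀, hz₀, hmin⟩ := hc.exists_isMinOn hne hf.1.continuousOn
  obtain ⟨z₁, -, hmax⟩ := hc.exists_isMaxOn hne (hk.1.abs).continuousOn
  have h0 : 0 < f z₀ := hpos z₀ (by rintro rfl; simp at hz₀)
  have hC : 0 < |k z₁| + 1 := by positivity
  -- Minimum of f over maximum of |k| on the sphere; the 1 guards against k = 0.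
  refine ⟨f z₀ / (|k z₁| + 1), by positivity, fun ε hε z hz =>
    (hf.add_mul hk ε).pos_of_sphere (fun y hy => ?_) hz⟩
  have hy' : y ∈ Metric.sphere (0 : E) 1 := by simpa using hy
  have h1 : f z₀ ≤ f y := hmin hy'
  have h2 : |k y| ≤ |k z₁| := hmax hy'
  have h3 : |ε| * (|k z₁| + 1) < f z₀ := (lt_div_iff₀ hC).1 hε
  have h4 : |ε * k y| ≤ |ε| * (|k z₁| + 1) := by
    rw [abs_mul]
    exact mul_le_mul_of_nonneg_left (by linarith) (abs_nonneg _)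
  have h5 := neg_abs_le (ε * k y)
  linarith

/-- Strict S-lemma without a regularity assumption. -/
theorem strict_s_lemma {g h : E → ℝ} (hg : IsQuadratic g) (hh : IsQuadratic h)
    (H : ∀ z, z ≠ 0 → 0 ≤ h z → 0 < g z) :
    ∃ α > 0, ∀ z, z ≠ 0 → 0 < g z + -α * h z := by
  -- The multiplier is inverted later, so it must not be zero. Strictness leaves room to increase a
  -- nonnegative one.
  suffices hα : ∃ α : ℝ, 0 ≤ α ∧ ∀ z : E, ‖z‖ = 1 → 0 < g z + -α * h z by
    obtain ⟨α, h0, hα⟩ := hα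
    obtain ⟨δ, hδ, hp⟩ := exists_perturbation (hg.add_mul hh (-α)) hh
      fun z hz => (hg.add_mul hh (-α)).pos_of_sphere hα hz
    refine ⟨α + δ / 2, by linarith, fun z hz => ?_⟩
    have := hp (-(δ / 2)) (by rw [abs_neg, abs_of_pos (by linarith)]; linarith) z hz
    linarith
  -- If every α ≥ 0 fails, split the α by the sign of h at a unit vector witnessing the failure. The
  -- two sets are closed, cover the half-line and are both nonempty, so connectedness gives one α
  -- with witnesses of both signs.
  by_contra! hcon
  set S := Metric.sphere (0 : E) 1 with hS
  have hc : IsCompact S := isCompact_sphere _ _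
  have hS0 : ∀ z ∈ S, z ≠ 0 := by rintro z hz rfl; simp [hS] at hz
  have hclosed : ∀ k : E → ℝ, Continuous k →
      IsClosed {α : ℝ | ∃ z ∈ S, g z ≤ α * h z ∧ 0 ≤ k z} := by
    intro k hk
    have hcl : IsClosed {x : ℝ × S | g x.2 ≤ x.1 * h x.2 ∧ 0 ≤ k x.2} :=
      (isClosed_le (hg.1.comp (continuous_subtype_val.comp continuous_snd))
        (continuous_fst.mul (hh.1.comp (continuous_subtype_val.comp continuous_snd)))).inter
        (isClosed_le continuous_const (hk.comp (continuous_subtype_val.comp continuous_snd)))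
    have : CompactSpace S := isCompact_iff_compactSpace.1 hc
    have := isClosedMap_fst_of_compactSpace (X := ℝ) (Y := S) _ hcl
    convert this using 1
    ext α
    simp only [Set.mem_ofPred_eq, Set.mem_image, Prod.exists, Subtype.exists]
    exact ⟨fun ⟨z, hz, h'⟩ => ⟨α, z, hz, h', rfl⟩, fun ⟨_, z, hz, h', e⟩ => e ▸ ⟨z, hz, h'⟩⟩
  have hpc := isPreconnected_closed_iff.1 (isPreconnected_Ici (a := (0 : ℝ)))
    _ _ (hclosed h hh.1) (hclosed (fun z => -h z) hh.1.neg) (fun α hα => by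
      obtain ⟨z, hz, hz'⟩ := hcon α hα
      rcases le_total 0 (h z) with h0 | h0
      · exact Or.inl ⟨z, by simpa [hS] using hz, by linarith, h0⟩
      · exact Or.inr ⟨z, by simpa [hS] using hz, by linarith, by linarith⟩)
  -- At α = 0 a witness has g ≤ 0, which excludes h ≥ 0.
  have hN : (Set.Ici (0 : ℝ) ∩ {α : ℝ | ∃ z ∈ S, g z ≤ α * h z ∧ 0 ≤ -h z}).Nonempty := by
    obtain ⟨z, hz, hz'⟩ := hcon 0 le_rfl
    have hz1 : z ∈ S := by simpa [hS] using hz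
    refine ⟨0, Set.self_mem_Ici, z, hz1, by linarith, ?_⟩
    by_contra hn
    have := H z (hS0 z hz1) (by linarith)
    linarith
  -- On the compact set where g ≤ 0, h is bounded above by a negative number and g is bounded below.
  -- For large α, no point with h < 0 can therefore be a witness.
  have hP : (Set.Ici (0 : ℝ) ∩ {α : ℝ | ∃ z ∈ S, g z ≤ α * h z ∧ 0 ≤ h z}).Nonempty := by
    have hK : IsCompact (S ∩ {z | g z ≤ 0}) := hc.inter_right (isClosed_le hg.1 continuous_const)
    obtain ⟨z₂, hz₂, hz₂'⟩ := hcon 0 le_rfl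
    have hKne : (S ∩ {z | g z ≤ 0}).Nonempty :=
      ⟨z₂, by simpa [hS] using hz₂, by simpa using hz₂'⟩
    obtain ⟨z₀, hz₀, hmax⟩ := hK.exists_isMaxOn hKne hh.1.continuousOn
    obtain ⟨z₁, hz₁, hmin⟩ := hK.exists_isMinOn hKne hg.1.continuousOn
    have hneg : h z₀ < 0 := by
      by_contra! hn
      have := H z₀ (hS0 _ hz₀.1) hn
      exact absurd hz₀.2 (not_le.2 this)
    have hα0 : 0 ≤ (-g z₁) / (-h z₀) := div_nonneg (by simpa using hz₁.2) (by linarith)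
    refine ⟨(-g z₁) / (-h z₀) + 1, Set.mem_Ici.2 (by linarith), ?_⟩
    obtain ⟨z, hz, hz'⟩ := hcon ((-g z₁) / (-h z₀) + 1) (by linarith)
    have hzS : z ∈ S := by simpa [hS] using hz
    refine ⟨z, hzS, by linarith, ?_⟩
    by_contra! hn
    have hgz : g z ≤ 0 := by nlinarith
    have h1 : h z ≤ h z₀ := hmax ⟨hzS, hgz⟩
    have h2 : g z₁ ≤ g z := hmin ⟨hzS, hgz⟩
    have h3 : (-g z₁) / (-h z₀) * (-h z₀) = -g z₁ := div_mul_cancel₀ _ (by linarith)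
    nlinarith
  obtain ⟨α, -, ⟨a, ha, ha1, ha2⟩, b, hb, hb1, hb2⟩ := hpc hP hN
  exact hg.not_nonpos_pair hh H (hS0 a ha) (hS0 b hb) ha1 hb1 ha2 (by linarith)

end Quadratic

/-! ### Real quadratic forms of block matrices -/

section QuadraticForms

variable {ι κ : Type*} [Fintype ι] [Fintype κ]

theorem posDef_real_iff {A : Matrix ι ι ℝ} :
    A.PosDef ↔ A.IsSymm ∧ ∀ x, x ≠ 0 → 0 < x ⬝ᵥ (A *ᵥ x) := by
  rw [posDef_iff_dotProduct_mulVec]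
  simp [IsHermitian, IsSymm, conjTranspose_eq_transpose_of_trivial]

theorem posSemidef_real_iff {A : Matrix ι ι ℝ} :
    A.PosSemidef ↔ A.IsSymm ∧ ∀ x, 0 ≤ x ⬝ᵥ (A *ᵥ x) := by
  rw [posSemidef_iff_dotProduct_mulVec]
  simp [IsHermitian, IsSymm, conjTranspose_eq_transpose_of_trivial]

/-- Moving a matrix to the other side of a dot product. -/
theorem dotProduct_transpose_mulVec_comm (B : Matrix ι κ ℝ) (a : κ → ℝ) (b : ι → ℝ) :
    a ⬝ᵥ (Bᵀ *ᵥ b) = b ⬝ᵥ (B *ᵥ a) := by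
  rw [mulVec_transpose, dotProduct_comm, ← dotProduct_mulVec]

theorem _root_.Matrix.IsSymm.dotProduct_mulVec_comm {A : Matrix ι ι ℝ} (hA : A.IsSymm)
    (a b : ι → ℝ) : a ⬝ᵥ (A *ᵥ b) = b ⬝ᵥ (A *ᵥ a) := by
  conv_lhs => rw [← hA.eq]
  exact dotProduct_transpose_mulVec_comm A a b

theorem dotProduct_fromBlocks_symm (A : Matrix ι ι ℝ) (B : Matrix κ ι ℝ) (D : Matrix κ κ ℝ)
    (a : ι → ℝ) (b : κ → ℝ) :
    Sum.elim a b ⬝ᵥ (fromBlocks A Bᵀ B D *ᵥ Sum.elim a b) =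
      a ⬝ᵥ (A *ᵥ a) + 2 * (b ⬝ᵥ (B *ᵥ a)) + b ⬝ᵥ (D *ᵥ b) := by
  rw [fromBlocks_mulVec, sumElim_dotProduct_sumElim]
  simp only [Sum.elim_comp_inl, Sum.elim_comp_inr, dotProduct_add,
    dotProduct_transpose_mulVec_comm]
  ring

/-- Completing the square. -/
theorem _root_.Matrix.PosDef.complete_square [DecidableEq ι] {K : Matrix ι ι ℝ} (hK : K.PosDef)
    (y b : ι → ℝ) :
    y ⬝ᵥ (K⁻¹ *ᵥ y) + 2 * (y ⬝ᵥ b) =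
      (y + K *ᵥ b) ⬝ᵥ (K⁻¹ *ᵥ (y + K *ᵥ b)) - b ⬝ᵥ (K *ᵥ b) := by
  have hs : K⁻¹.IsSymm := (posDef_real_iff.1 hK.inv).1
  have h1 : K⁻¹ *ᵥ (K *ᵥ b) = b := by
    rw [mulVec_mulVec, nonsing_inv_mul _ ((isUnit_iff_isUnit_det _).1 hK.isUnit), one_mulVec]
  have h2 : (K *ᵥ b) ⬝ᵥ (K⁻¹ *ᵥ y) = y ⬝ᵥ b := by
    rw [hs.dotProduct_mulVec_comm, h1]
  simp only [mulVec_add, add_dotProduct, dotProduct_add, h1, h2, dotProduct_comm (K *ᵥ b) b]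
  ring

theorem _root_.Matrix.PosSemidef.quad_nonneg {K : Matrix ι ι ℝ} (hK : K.PosSemidef)
    (x : ι → ℝ) : 0 ≤ x ⬝ᵥ (K *ᵥ x) := (posSemidef_real_iff.1 hK).2 x

/-- A positive definite form vanishes only at `0`. -/
theorem _root_.Matrix.PosDef.eq_zero_of_quad_nonpos {K : Matrix ι ι ℝ} (hK : K.PosDef)
    {x : ι → ℝ} (h : x ⬝ᵥ (K *ᵥ x) ≤ 0) : x = 0 := by
  by_contra hx
  exact absurd ((posDef_real_iff.1 hK).2 x hx) (not_lt.2 h)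

end QuadraticForms

/-! ### Dissipation inequality and its linearized form -/

section Analysis

variable {ι κ : Type*} [Fintype ι] [Fintype κ] {q pz pzt pt : ℕ}

/-- The value of the strict dissipation inequality at a state `x` and a disturbance `w`, with
successor state `η` and performance output `z`. -/
def dissVal (P : Matrix ι ι ℝ) (Q : Matrix (Fin q) (Fin q) ℝ) (S : Matrix (Fin q) (Fin pz) ℝ)
    (R : Matrix (Fin pz) (Fin pz) ℝ) (x η : ι → ℝ) (w : Fin q → ℝ) (z : Fin pz → ℝ) : ℝ :=
  x ⬝ᵥ (P *ᵥ x) - η ⬝ᵥ (P *ᵥ η) - w ⬝ᵥ (Q *ᵥ w) - 2 * (w ⬝ᵥ (S *ᵥ z)) - z ⬝ᵥ (R *ᵥ z)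

theorem dissipationIneq_iff [DecidableEq ι] {A : Matrix ι ι ℝ} {B : Matrix ι (Fin q) ℝ}
    {C : Matrix (Fin pz) ι ℝ} {D : Matrix (Fin pz) (Fin q) ℝ} {Q : Matrix (Fin q) (Fin q) ℝ}
    {S : Matrix (Fin q) (Fin pz) ℝ} {R : Matrix (Fin pz) (Fin pz) ℝ} {P : Matrix ι ι ℝ}
    (hP : P.IsSymm) (hQ : Q.IsSymm) (hR : R.IsSymm) :
    DissipationIneq A B C D Q S R P ↔
      ∀ (x : ι → ℝ) (w : Fin q → ℝ), ¬ (x = 0 ∧ w = 0) →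
        0 < dissVal P Q S R x (A *ᵥ x + B *ᵥ w) w (C *ᵥ x + D *ᵥ w) := by
  have hsymm : (fromBlocks (fromBlocks (-P) 0 0 P) 0 0 (fromBlocks Q S Sᵀ R)).IsSymm := by
    rw [isSymm_fromBlocks_iff, isSymm_fromBlocks_iff, isSymm_fromBlocks_iff]
    simp [hP, hQ, hR, IsSymm.neg hP]
  have hval : ∀ (x : ι → ℝ) (w : Fin q → ℝ),
      Sum.elim x w ⬝ᵥ ((-((dissOuter A B C D)ᵀ *
        fromBlocks (fromBlocks (-P) 0 0 P) 0 0 (fromBlocks Q S Sᵀ R) *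
        dissOuter A B C D)) *ᵥ Sum.elim x w) =
      dissVal P Q S R x (A *ᵥ x + B *ᵥ w) w (C *ᵥ x + D *ᵥ w) := by
    intro x w
    rw [neg_mulVec, dotProduct_neg, ← mulVec_mulVec, ← mulVec_mulVec,
      dotProduct_transpose_mulVec_comm, dotProduct_comm]
    have ho : dissOuter A B C D *ᵥ Sum.elim x w =
        Sum.elim (Sum.elim x (A *ᵥ x + B *ᵥ w)) (Sum.elim w (C *ᵥ x + D *ᵥ w)) := by
      simp [dissOuter, fromRows_mulVec, fromBlocks_mulVec]
    rw [ho]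
    generalize A *ᵥ x + B *ᵥ w = η
    generalize C *ᵥ x + D *ᵥ w = z
    simp only [fromBlocks_mulVec, Sum.elim_comp_inl, Sum.elim_comp_inr, zero_mulVec, add_zero,
      zero_add, sumElim_dotProduct_sumElim, dissVal, neg_mulVec,
      dotProduct_add, dotProduct_transpose_mulVec_comm, dotProduct_neg]
    ring
  rw [DissipationIneq, posDef_real_iff]
  constructor
  · rintro ⟨-, h⟩ x w hxw
    rw [← hval]
    refine h _ fun h0 => hxw ⟨?_, ?_⟩
    · simpa using congrArg (· ∘ Sum.inl) h0
    · simpa using congrArg (· ∘ Sum.inr) h0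
  · intro h
    refine ⟨IsSymm.neg ?_, fun v hv => ?_⟩
    · rw [IsSymm, transpose_mul, transpose_mul, transpose_transpose, hsymm.eq, Matrix.mul_assoc]
    · rw [← Sum.elim_comp_inl_inr v, hval]
      refine h _ _ fun ⟨h1, h2⟩ => hv ?_
      rw [← Sum.elim_comp_inl_inr v, h1, h2]
      exact Sum.elim_zero_zero

/-- The matrix of the linearized dissipation inequality of an uncertain system, in which the
quadratic dependence on the system matrices and on the uncertainty has been resolved. -/
noncomputable def analysisMat (P Pi A : Matrix ι ι ℝ) (B : Matrix ι (Fin q) ℝ)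
    (C : Matrix (Fin pz) ι ℝ) (D : Matrix (Fin pz) (Fin q) ℝ)
    (Q : Matrix (Fin q) (Fin q) ℝ) (S : Matrix (Fin q) (Fin pz) ℝ)
    (T : Matrix (Fin pz) (Fin pzt) ℝ) (Rt : Matrix (Fin pzt) (Fin pzt) ℝ)
    (Ex : Matrix κ ι ℝ) (Ew : Matrix κ (Fin q) ℝ) (M : Matrix ι (Fin pt) ℝ)
    (K : Matrix κ κ ℝ) (Λ : Matrix (Fin pt) (Fin pt) ℝ) (α : ℝ) :
    Matrix ((ι ⊕ (Fin q ⊕ Fin pzt)) ⊕ (ι ⊕ (κ ⊕ Fin pt)))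
      ((ι ⊕ (Fin q ⊕ Fin pzt)) ⊕ (ι ⊕ (κ ⊕ Fin pt))) ℝ :=
  fromBlocks
    (fromBlocks P (fromRows (-(S * C)) (Tᵀ * C))ᵀ (fromRows (-(S * C)) (Tᵀ * C))
      (fromBlocks (-Q - ((S * D)ᵀ + S * D)) (Tᵀ * D)ᵀ (Tᵀ * D) Rt⁻¹))
    (fromBlocks A (fromCols B 0) (fromRows Ex 0) (fromRows (fromCols Ew 0) 0))ᵀ
    (fromBlocks A (fromCols B 0) (fromRows Ex 0) (fromRows (fromCols Ew 0) 0))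
    (fromBlocks Pi (fromRows 0 (α • Mᵀ))ᵀ (fromRows 0 (α • Mᵀ))
      (fromBlocks (-(α • K)) 0 0 (α • Λ⁻¹)))

variable {P Pi A : Matrix ι ι ℝ} {B : Matrix ι (Fin q) ℝ}
    {C : Matrix (Fin pz) ι ℝ} {D : Matrix (Fin pz) (Fin q) ℝ}
    {Q : Matrix (Fin q) (Fin q) ℝ} {S : Matrix (Fin q) (Fin pz) ℝ}
    {T : Matrix (Fin pz) (Fin pzt) ℝ} {Rt : Matrix (Fin pzt) (Fin pzt) ℝ}
    {Ex : Matrix κ ι ℝ} {Ew : Matrix κ (Fin q) ℝ} {M : Matrix ι (Fin pt) ℝ}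
    {K : Matrix κ κ ℝ} {Λ : Matrix (Fin pt) (Fin pt) ℝ} {α : ℝ}

/-- The grouping prepares completion of squares: y resolves the term in R, ξ the term in P at the
successor state, and v and f the quadratic constraint on the uncertainty. -/
theorem analysisMat_quad (x : ι → ℝ) (w : Fin q → ℝ) (y : Fin pzt → ℝ) (ξ : ι → ℝ) (v : κ → ℝ)
    (f : Fin pt → ℝ) :
    Sum.elim (Sum.elim x (Sum.elim w y)) (Sum.elim ξ (Sum.elim v f)) ⬝ᵥ
      (analysisMat P Pi A B C D Q S T Rt Ex Ew M K Λ α *ᵥ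
        Sum.elim (Sum.elim x (Sum.elim w y)) (Sum.elim ξ (Sum.elim v f))) =
    x ⬝ᵥ (P *ᵥ x) - w ⬝ᵥ (Q *ᵥ w) - 2 * (w ⬝ᵥ (S *ᵥ (C *ᵥ x + D *ᵥ w)))
      + (y ⬝ᵥ (Rt⁻¹ *ᵥ y) + 2 * (y ⬝ᵥ (Tᵀ *ᵥ (C *ᵥ x + D *ᵥ w))))
      + (ξ ⬝ᵥ (Pi *ᵥ ξ) + 2 * (ξ ⬝ᵥ (A *ᵥ x + B *ᵥ w)))
      + (2 * (v ⬝ᵥ (Ex *ᵥ x + Ew *ᵥ w)) - α * (v ⬝ᵥ (K *ᵥ v)))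
      + α * (f ⬝ᵥ (Λ⁻¹ *ᵥ f) + 2 * (f ⬝ᵥ (Mᵀ *ᵥ ξ))) := by
  have e1 := dotProduct_transpose_mulVec_comm (S * D) w w
  rw [analysisMat, dotProduct_fromBlocks_symm, dotProduct_fromBlocks_symm,
    dotProduct_fromBlocks_symm, dotProduct_fromBlocks_symm]
  simp only [fromBlocks_mulVec, fromRows_mulVec, fromCols_mulVec, Sum.elim_comp_inl,
    Sum.elim_comp_inr, zero_mulVec, add_zero, zero_add, sumElim_dotProduct_sumElim, sub_mulVec,
    add_mulVec, e1, neg_mulVec, dotProduct_neg, dotProduct_add, dotProduct_sub, smul_mulVec,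
    dotProduct_smul, smul_eq_mul, mulVec_add, dotProduct_zero, ← mulVec_mulVec]
  ring

theorem analysisMat_isSymm (hP : P.IsSymm) (hPi : Pi.IsSymm) (hQ : Q.IsSymm)
    (hRt : Rt.IsSymm) (hK : K.IsSymm) (hΛ : Λ.IsSymm) :
    (analysisMat P Pi A B C D Q S T Rt Ex Ew M K Λ α).IsSymm := by
  simp only [analysisMat, IsSymm, fromBlocks_transpose, transpose_transpose, hP.eq, hPi.eq,
    transpose_neg, transpose_sub, transpose_add, transpose_smul, hQ.eq, hK.eq, transpose_zero,
    transpose_nonsing_inv, hRt.eq, hΛ.eq]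
  rw [add_comm (S * D)]

/-- Congruence transformation of the states. -/
theorem analysisMat_congr [DecidableEq κ] (V Z : Matrix ι ι ℝ) :
    (fromBlocks (fromBlocks V 0 0 1) 0 0 (fromBlocks Z 0 0 1))ᵀ *
      analysisMat P Pi A B C D Q S T Rt Ex Ew M K Λ α *
      fromBlocks (fromBlocks V 0 0 1) 0 0 (fromBlocks Z 0 0 1) =
    analysisMat (Vᵀ * P * V) (Zᵀ * Pi * Z) (Zᵀ * A * V) (Zᵀ * B) (C * V) D Q S T Rt
      (Ex * V) Ew (Zᵀ * M) K Λ α := by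
  simp only [analysisMat, fromBlocks_transpose, fromBlocks_multiply, transpose_zero,
    transpose_one, Matrix.mul_zero, Matrix.zero_mul, add_zero, zero_add, Matrix.one_mul,
    Matrix.mul_one, transpose_fromRows, transpose_fromCols, fromRows_mul, mul_fromCols,
    transpose_mul, transpose_neg, transpose_smul, Matrix.mul_assoc, Matrix.neg_mul,
    Matrix.mul_neg, transpose_transpose, Matrix.smul_mul, Matrix.mul_smul]

end Analysis

/-! ### Robust dissipativity and its multiplier certificate -/

section Robust

variable {ι κ : Type*} [Fintype ι] [Fintype κ]
    {p q pz pzt pt : ℕ}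
    {P A : Matrix ι ι ℝ} {B : Matrix ι (Fin q) ℝ}
    {C : Matrix (Fin pz) ι ℝ} {D : Matrix (Fin pz) (Fin q) ℝ}
    {Q : Matrix (Fin q) (Fin q) ℝ} {S : Matrix (Fin q) (Fin pz) ℝ}
    {T : Matrix (Fin pz) (Fin pzt) ℝ} {Rt : Matrix (Fin pzt) (Fin pzt) ℝ}
    {Ex : Matrix κ ι ℝ} {Ew : Matrix κ (Fin q) ℝ} {M₁ : Matrix ι (Fin p) ℝ}
    {Ξ : Matrix (Fin p) (Fin pt) ℝ}
    {K : Matrix κ κ ℝ} {Λ : Matrix (Fin pt) (Fin pt) ℝ} {α : ℝ}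

/-- The linearized inequality certifies the dissipation inequality of every uncertain system. -/
theorem dissVal_pos_of_analysisMat_posDef [DecidableEq ι] (hP : P.PosDef)
    (hRt : Rt.PosDef) (hΛ : Λ.PosDef) (hK : (-K).PosDef)
    (hpos : (analysisMat P P⁻¹ A B C D Q S T Rt Ex Ew (M₁ * Ξ) K Λ α).PosDef)
    {Δ : Matrix (Fin p) κ ℝ} (hΔ : (Ξ * Λ * Ξᵀ + Δ * K * Δᵀ).PosSemidef)
    (x : ι → ℝ) (w : Fin q → ℝ) (hxw : ¬ (x = 0 ∧ w = 0)) :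
    0 < dissVal P Q S (T * Rt * Tᵀ) x ((A + M₁ * Δ * Ex) *ᵥ x + (B + M₁ * Δ * Ew) *ᵥ w) w
      (C *ᵥ x + D *ᵥ w) := by
  have hK0 : ∀ v, v ⬝ᵥ (K *ᵥ v) ≤ 0 := fun v => by
    have := hK.posSemidef.quad_nonneg v
    rw [neg_mulVec, dotProduct_neg] at this
    linarith
  set z := C *ᵥ x + D *ᵥ w with hz
  set c := Ex *ᵥ x + Ew *ᵥ w with hc
  set η₀ := A *ᵥ x + B *ᵥ w with hη₀
  have hη : (A + M₁ * Δ * Ex) *ᵥ x + (B + M₁ * Δ * Ew) *ᵥ w = η₀ + M₁ *ᵥ (Δ *ᵥ c) := by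
    simp only [hc, hη₀, add_mulVec, mulVec_add, ← mulVec_mulVec]
    abel
  rw [hη]
  set η := η₀ + M₁ *ᵥ (Δ *ᵥ c) with hηdef
  -- The vectors y, ξ and f annihilate their completed squares, and v = Δᵀσ cancels the cross term
  -- of the uncertainty. What remains is the dissipation value minus α σᵀ(ΞΛΞᵀ + ΔKΔᵀ)σ.
  set ξ := -(P *ᵥ η) with hξ
  set σ := M₁ᵀ *ᵥ ξ with hσ
  set v := Δᵀ *ᵥ σ with hv
  set b := (M₁ * Ξ)ᵀ *ᵥ ξ with hb
  have hbσ : b = Ξᵀ *ᵥ σ := by rw [hb, transpose_mul, ← mulVec_mulVec]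
  set f := -(Λ *ᵥ b) with hf
  have hval := (posDef_real_iff.1 hpos).2
    (Sum.elim (Sum.elim x (Sum.elim w (-(Rt *ᵥ (Tᵀ *ᵥ z))))) (Sum.elim ξ (Sum.elim v f)))
    (fun h0 => hxw ⟨funext fun i => congrFun h0 (.inl (.inl i)),
      funext fun i => congrFun h0 (.inl (.inr (.inl i)))⟩)
  rw [analysisMat_quad, ← hz, ← hη₀, ← hc, ← hb, hRt.complete_square, hΛ.complete_square] at hval
  have h1 := hP.complete_square ξ η
  have hcross : v ⬝ᵥ c = ξ ⬝ᵥ (M₁ *ᵥ (Δ *ᵥ c)) := by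
    rw [hv, dotProduct_comm, dotProduct_transpose_mulVec_comm, hσ, dotProduct_comm,
      dotProduct_transpose_mulVec_comm]
  have hR : (Tᵀ *ᵥ z) ⬝ᵥ (Rt *ᵥ (Tᵀ *ᵥ z)) = z ⬝ᵥ ((T * Rt * Tᵀ) *ᵥ z) := by
    rw [← mulVec_mulVec, ← mulVec_mulVec, dotProduct_comm, dotProduct_mulVec z T,
      ← mulVec_transpose, dotProduct_comm]
  have hα : α * (v ⬝ᵥ (K *ᵥ v) + b ⬝ᵥ (Λ *ᵥ b)) ≥ 0 := by
    rcases le_or_gt 0 α with h0 | h0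
    · refine mul_nonneg h0 ?_
      have := hΔ.quad_nonneg σ
      rw [add_mulVec, dotProduct_add, ← mulVec_mulVec, ← mulVec_mulVec, ← mulVec_mulVec,
        ← mulVec_mulVec, ← hv, ← hbσ, dotProduct_mulVec σ Ξ, dotProduct_mulVec σ Δ,
        ← mulVec_transpose, ← mulVec_transpose, ← hv, ← hbσ] at this
      linarith
    -- A negative α makes the diagonal blocks -αK and αΛ⁻¹ negative definite, so positivity of the
    -- whole matrix forces v and f to vanish. No sign condition on α is needed.
    · have hv0 : v = 0 := by
        by_contra hne
        have := (posDef_real_iff.1 hpos).2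
          (Sum.elim (Sum.elim 0 (Sum.elim 0 0)) (Sum.elim 0 (Sum.elim v 0)))
          (fun h0 => hne (funext fun i => congrFun h0 (.inr (.inr (.inl i)))))
        rw [analysisMat_quad] at this
        simp only [mulVec_zero, dotProduct_zero, add_zero, mul_zero] at this
        nlinarith [hK0 v]
      have hf0 : f = 0 := by
        by_contra hne
        have := (posDef_real_iff.1 hpos).2
          (Sum.elim (Sum.elim 0 (Sum.elim 0 0)) (Sum.elim 0 (Sum.elim 0 f)))
          (fun h0 => hne (funext fun i => congrFun h0 (.inr (.inr (.inr i)))))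
        rw [analysisMat_quad] at this
        simp only [mulVec_zero, dotProduct_zero, add_zero, mul_zero] at this
        nlinarith [hΛ.inv.posSemidef.quad_nonneg f]
      have hΛb : Λ *ᵥ b = 0 := by simpa [hf] using hf0
      simp [hv0, hΛb]
  simp only [hξ, hf, neg_add_cancel, mulVec_zero, dotProduct_zero] at hval h1
  rw [← hξ] at h1 hval
  simp only [hηdef, dotProduct_add] at h1
  rw [← hηdef] at h1
  rw [dissVal]
  linarith [hval, hcross, h1, hR, hα]

/-- Rank-one uncertainties reach every admissible output of the uncertainty channel. -/
theorem exists_uncertainty [DecidableEq κ] (hΛ : Λ.PosDef) (hK : (-K).PosDef) (c : κ → ℝ)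
    (f : Fin pt → ℝ) (h : f ⬝ᵥ (Λ⁻¹ *ᵥ f) ≤ c ⬝ᵥ ((-K)⁻¹ *ᵥ c)) :
    ∃ Δ : Matrix (Fin p) κ ℝ, (Ξ * Λ * Ξᵀ + Δ * K * Δᵀ).PosSemidef ∧ Δ *ᵥ c = Ξ *ᵥ f := by
  have hsK : (-K).IsSymm := (posDef_real_iff.1 hK).1
  have hsK' : K.IsSymm := by simpa using hsK.neg
  have hsΛ : Λ.IsSymm := (posDef_real_iff.1 hΛ).1
  have hsymm : ∀ Δ : Matrix (Fin p) κ ℝ, (Ξ * Λ * Ξᵀ + Δ * K * Δᵀ).IsSymm := fun Δ => by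
    simp [IsSymm, transpose_mul, hsK'.eq, hsΛ.eq, Matrix.mul_assoc]
  rcases (hK.inv.posSemidef.quad_nonneg c).eq_or_lt with h0 | h0
  · have hf : f = 0 := hΛ.inv.eq_zero_of_quad_nonpos (by linarith)
    refine ⟨0, ?_, by simp [hf]⟩
    simpa using hΛ.posSemidef.mul_mul_conjTranspose_same Ξ
  set ρ := c ⬝ᵥ ((-K)⁻¹ *ᵥ c) with hρ
  set d := (-K)⁻¹ *ᵥ c with hd
  have hKd : (-K) *ᵥ d = c := by
    rw [hd, mulVec_mulVec, mul_nonsing_inv _ ((isUnit_iff_isUnit_det _).1 hK.isUnit), one_mulVec]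
  have hdd : d ⬝ᵥ (K *ᵥ d) = -ρ := by
    have : d ⬝ᵥ ((-K) *ᵥ d) = ρ := by rw [hKd, dotProduct_comm, hρ]
    rw [neg_mulVec, dotProduct_neg] at this
    linarith
  -- Since d ⬝ᵥ c = ρ, this rank-one matrix sends c to Ξf. It satisfies ΔKΔᵀ = -ρ⁻¹(Ξf)(Ξf)ᵀ, so
  -- admissibility becomes (f·b)² ≤ ρ bᵀΛb, a Cauchy–Schwarz inequality.
  refine ⟨vecMulVec (ρ⁻¹ • Ξ *ᵥ f) d, posSemidef_real_iff.2 ⟨hsymm _, fun s => ?_⟩, ?_⟩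
  · set b := Ξᵀ *ᵥ s with hb
    have h1 : s ⬝ᵥ ((Ξ * Λ * Ξᵀ) *ᵥ s) = b ⬝ᵥ (Λ *ᵥ b) := by
      rw [← mulVec_mulVec, ← mulVec_mulVec, dotProduct_mulVec, ← mulVec_transpose]
    have h3 : (vecMulVec (ρ⁻¹ • Ξ *ᵥ f) d)ᵀ *ᵥ s = (ρ⁻¹ * (f ⬝ᵥ b)) • d := by
      rw [transpose_vecMulVec, vecMulVec_mulVec, smul_dotProduct, dotProduct_comm (Ξ *ᵥ f),
        dotProduct_mulVec, ← mulVec_transpose, ← hb, dotProduct_comm b]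
      ext i
      simp only [Pi.smul_apply, smul_eq_mul, MulOpposite.smul_eq_mul_unop, MulOpposite.unop_op]
      ring
    have h2 : s ⬝ᵥ ((vecMulVec (ρ⁻¹ • Ξ *ᵥ f) d * K * (vecMulVec (ρ⁻¹ • Ξ *ᵥ f) d)ᵀ) *ᵥ s) =
        -(ρ⁻¹ * (f ⬝ᵥ b) ^ 2) := by
      rw [← mulVec_mulVec, ← mulVec_mulVec, dotProduct_mulVec, ← mulVec_transpose, h3,
        mulVec_smul, smul_dotProduct, dotProduct_smul, hdd]
      simp only [smul_eq_mul]
      field_simp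
    rw [add_mulVec, dotProduct_add, h1, h2]
    have hcs : ∀ t : ℝ, 0 ≤ ρ + 2 * (t * (f ⬝ᵥ b)) + t ^ 2 * (b ⬝ᵥ (Λ *ᵥ b)) := fun t => by
      have e := hΛ.complete_square f (t • b)
      have := hΛ.inv.posSemidef.quad_nonneg (f + Λ *ᵥ (t • b))
      simp only [mulVec_smul, smul_dotProduct, dotProduct_smul, smul_eq_mul] at e this
      nlinarith
    have h4 := hΛ.posSemidef.quad_nonneg b
    rcases h4.eq_or_lt with h5 | h5
    · have hb0 : b = 0 := hΛ.eq_zero_of_quad_nonpos h5.ge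
      simp [hb0]
    -- The minimizer of the quadratic polynomial in t.
    · have h6 := hcs (-(f ⬝ᵥ b) / (b ⬝ᵥ (Λ *ᵥ b)))
      have h7 : ρ⁻¹ * (f ⬝ᵥ b) ^ 2 ≤ b ⬝ᵥ (Λ *ᵥ b) := by
        rw [inv_mul_le_iff₀ h0]
        field_simp at h6
        nlinarith
      linarith
  · rw [vecMulVec_mulVec, dotProduct_comm, ← hρ]
    ext i
    simp only [Pi.smul_apply, smul_eq_mul, MulOpposite.smul_eq_mul_unop, MulOpposite.unop_op]
    field_simp

/-- The value of the dissipation inequality in terms of the state, the disturbance and the output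
of the uncertainty. -/
def dissForm (P A : Matrix ι ι ℝ) (B : Matrix ι (Fin q) ℝ)
    (C : Matrix (Fin pz) ι ℝ) (D : Matrix (Fin pz) (Fin q) ℝ) (Q : Matrix (Fin q) (Fin q) ℝ)
    (S : Matrix (Fin q) (Fin pz) ℝ) (R : Matrix (Fin pz) (Fin pz) ℝ) (M : Matrix ι (Fin pt) ℝ)
    (ζ : (ι → ℝ) × (Fin q → ℝ) × (Fin pt → ℝ)) : ℝ :=
  dissVal P Q S R ζ.1 (A *ᵥ ζ.1 + B *ᵥ ζ.2.1 + M *ᵥ ζ.2.2) ζ.2.1 (C *ᵥ ζ.1 + D *ᵥ ζ.2.1)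

/-- The quadratic constraint on the input and the output of the uncertainty. -/
noncomputable def uncForm [DecidableEq κ] (Ex : Matrix κ ι ℝ) (Ew : Matrix κ (Fin q) ℝ)
    (K : Matrix κ κ ℝ) (Λ : Matrix (Fin pt) (Fin pt) ℝ)
    (ζ : (ι → ℝ) × (Fin q → ℝ) × (Fin pt → ℝ)) : ℝ :=
  (Ex *ᵥ ζ.1 + Ew *ᵥ ζ.2.1) ⬝ᵥ ((-K)⁻¹ *ᵥ (Ex *ᵥ ζ.1 + Ew *ᵥ ζ.2.1)) -
    ζ.2.2 ⬝ᵥ (Λ⁻¹ *ᵥ ζ.2.2)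

/-- A bilinear expression in two continuous linear images of the argument is quadratic. -/
theorem isQuadratic_dotProduct {E : Type*} [NormedAddCommGroup E] [NormedSpace ℝ E]
    [FiniteDimensional ℝ E] (L L' : E →ₗ[ℝ] (κ → ℝ)) :
    IsQuadratic fun ζ => L ζ ⬝ᵥ L' ζ := by
  refine ⟨L.continuous_of_finiteDimensional.dotProduct L'.continuous_of_finiteDimensional,
    fun a b => L a ⬝ᵥ L' b + L b ⬝ᵥ L' a, fun a b s t => ?_⟩
  simp only [map_add, map_smul, add_dotProduct, dotProduct_add, smul_dotProduct, dotProduct_smul,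
    smul_eq_mul]
  ring

theorem isQuadratic_dissForm (P A : Matrix ι ι ℝ) (B : Matrix ι (Fin q) ℝ)
    (C : Matrix (Fin pz) ι ℝ) (D : Matrix (Fin pz) (Fin q) ℝ) (Q : Matrix (Fin q) (Fin q) ℝ)
    (S : Matrix (Fin q) (Fin pz) ℝ) (R : Matrix (Fin pz) (Fin pz) ℝ) (M : Matrix ι (Fin pt) ℝ) :
    IsQuadratic (dissForm P A B C D Q S R M) := by
  let x : (ι → ℝ) × (Fin q → ℝ) × (Fin pt → ℝ) →ₗ[ℝ] (ι → ℝ) := LinearMap.fst _ _ _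
  let w : (ι → ℝ) × (Fin q → ℝ) × (Fin pt → ℝ) →ₗ[ℝ] (Fin q → ℝ) :=
    LinearMap.fst _ _ _ ∘ₗ LinearMap.snd _ _ _
  let f : (ι → ℝ) × (Fin q → ℝ) × (Fin pt → ℝ) →ₗ[ℝ] (Fin pt → ℝ) :=
    LinearMap.snd _ _ _ ∘ₗ LinearMap.snd _ _ _
  let η := A.mulVecLin ∘ₗ x + B.mulVecLin ∘ₗ w + M.mulVecLin ∘ₗ f
  let z := C.mulVecLin ∘ₗ x + D.mulVecLin ∘ₗ w
  convert ((((isQuadratic_dotProduct x (P.mulVecLin ∘ₗ x)).add_mul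
    (isQuadratic_dotProduct η (P.mulVecLin ∘ₗ η)) (-1)).add_mul
    (isQuadratic_dotProduct w (Q.mulVecLin ∘ₗ w)) (-1)).add_mul
    (isQuadratic_dotProduct w (S.mulVecLin ∘ₗ z)) (-2)).add_mul
    (isQuadratic_dotProduct z (R.mulVecLin ∘ₗ z)) (-1) using 2 with ζ
  simp only [dissForm, dissVal, x, w, f, η, z, LinearMap.add_apply, LinearMap.comp_apply,
    LinearMap.fst_apply, LinearMap.snd_apply, mulVecLin_apply]
  ring

theorem isQuadratic_uncForm [DecidableEq κ] (Ex : Matrix κ ι ℝ) (Ew : Matrix κ (Fin q) ℝ)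
    (K : Matrix κ κ ℝ) (Λ : Matrix (Fin pt) (Fin pt) ℝ) : IsQuadratic (uncForm Ex Ew K Λ) := by
  let x : (ι → ℝ) × (Fin q → ℝ) × (Fin pt → ℝ) →ₗ[ℝ] (ι → ℝ) := LinearMap.fst _ _ _
  let w : (ι → ℝ) × (Fin q → ℝ) × (Fin pt → ℝ) →ₗ[ℝ] (Fin q → ℝ) :=
    LinearMap.fst _ _ _ ∘ₗ LinearMap.snd _ _ _
  let f : (ι → ℝ) × (Fin q → ℝ) × (Fin pt → ℝ) →ₗ[ℝ] (Fin pt → ℝ) :=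
    LinearMap.snd _ _ _ ∘ₗ LinearMap.snd _ _ _
  let c := Ex.mulVecLin ∘ₗ x + Ew.mulVecLin ∘ₗ w
  convert (isQuadratic_dotProduct c ((-K)⁻¹.mulVecLin ∘ₗ c)).add_mul
    (isQuadratic_dotProduct f (Λ⁻¹.mulVecLin ∘ₗ f)) (-1) using 2 with ζ
  simp only [uncForm, x, w, f, c, LinearMap.add_apply, LinearMap.comp_apply,
    LinearMap.fst_apply, LinearMap.snd_apply, mulVecLin_apply]
  ring

/-- The certificate enters linearly, so perturbing it perturbs the form by one with zero supply
rate, as `exists_perturbation` requires. -/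
theorem dissForm_add_smul (P J A : Matrix ι ι ℝ) (B : Matrix ι (Fin q) ℝ)
    (C : Matrix (Fin pz) ι ℝ) (D : Matrix (Fin pz) (Fin q) ℝ) (Q : Matrix (Fin q) (Fin q) ℝ)
    (S : Matrix (Fin q) (Fin pz) ℝ) (R : Matrix (Fin pz) (Fin pz) ℝ) (M : Matrix ι (Fin pt) ℝ)
    (ε : ℝ) (ζ : (ι → ℝ) × (Fin q → ℝ) × (Fin pt → ℝ)) :
    dissForm (P + ε • J) A B C D Q S R M ζ =
      dissForm P A B C D Q S R M ζ +
        ε * dissForm J A B C D 0 0 (0 : Matrix (Fin pz) (Fin pz) ℝ) M ζ := by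
  simp only [dissForm, dissVal, add_mulVec, smul_mulVec, dotProduct_add, dotProduct_smul,
    smul_eq_mul, zero_mulVec, dotProduct_zero]
  ring

/-- Positivity of the Lagrange relaxation implies the linearized inequality. -/
theorem analysisMat_posDef_of_forms [DecidableEq ι] [DecidableEq κ] (hP : P.PosDef)
    (hQ : Q.IsSymm) (hRt : Rt.PosDef) (hΛ : Λ.PosDef) (hK : (-K).PosDef) {β : ℝ} (hβ : 0 < β)
    {M : Matrix ι (Fin pt) ℝ}
    (h : ∀ ζ, ζ ≠ 0 → 0 < dissForm P A B C D Q S (T * Rt * Tᵀ) M ζ + -β * uncForm Ex Ew K Λ ζ) :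
    (analysisMat P P⁻¹ A B C D Q S T Rt Ex Ew M K Λ β⁻¹).PosDef := by
  have hsK : K.IsSymm := by simpa using (posDef_real_iff.1 hK).1.neg
  refine posDef_real_iff.2 ⟨analysisMat_isSymm (posDef_real_iff.1 hP).1
    (posDef_real_iff.1 hP.inv).1 hQ (posDef_real_iff.1 hRt).1 hsK (posDef_real_iff.1 hΛ).1,
    fun v hv => ?_⟩
  obtain ⟨x, w, y, ξ, v, f, rfl⟩ : ∃ x w y ξ v' f,
      v = Sum.elim (Sum.elim x (Sum.elim w y)) (Sum.elim ξ (Sum.elim v' f)) :=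
    ⟨fun i => v (.inl (.inl i)), fun i => v (.inl (.inr (.inl i))),
      fun i => v (.inl (.inr (.inr i))), fun i => v (.inr (.inl i)),
      fun i => v (.inr (.inr (.inl i))), fun i => v (.inr (.inr (.inr i))), by
        ext ((i | i | i) | (i | i | i)) <;> rfl⟩
  rw [analysisMat_quad]
  set z := C *ᵥ x + D *ᵥ w with hz
  set c := Ex *ᵥ x + Ew *ᵥ w with hc
  set η₀ := A *ᵥ x + B *ᵥ w with hη₀
  -- The Lagrangian has multiplier β and the linearized matrix β⁻¹; this rescaling of the
  -- uncertainty channel matches them.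
  set g := β⁻¹ • f with hg
  have hval : dissForm P A B C D Q S (T * Rt * Tᵀ) M (x, w, g) + -β * uncForm Ex Ew K Λ (x, w, g)
      = x ⬝ᵥ (P *ᵥ x) - (η₀ + M *ᵥ g) ⬝ᵥ (P *ᵥ (η₀ + M *ᵥ g)) - w ⬝ᵥ (Q *ᵥ w)
        - 2 * (w ⬝ᵥ (S *ᵥ z)) - z ⬝ᵥ ((T * Rt * Tᵀ) *ᵥ z)
        - β * (c ⬝ᵥ ((-K)⁻¹ *ᵥ c) - g ⬝ᵥ (Λ⁻¹ *ᵥ g)) := by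
    simp only [dissForm, dissVal, uncForm, ← hz, ← hc, ← hη₀]
    ring
  have hR : (Tᵀ *ᵥ z) ⬝ᵥ (Rt *ᵥ (Tᵀ *ᵥ z)) = z ⬝ᵥ ((T * Rt * Tᵀ) *ᵥ z) := by
    rw [← mulVec_mulVec, ← mulVec_mulVec, dotProduct_comm, dotProduct_mulVec z T,
      ← mulVec_transpose, dotProduct_comm]
  have h1 := hRt.complete_square y (Tᵀ *ᵥ z)
  have h2 := hP.complete_square ξ (η₀ + M *ᵥ g)
  have h3 := hK.inv.complete_square v (β • c)
  rw [nonsing_inv_nonsing_inv _ ((isUnit_iff_isUnit_det _).1 hK.isUnit)] at h3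
  have h4 : f ⬝ᵥ (Mᵀ *ᵥ ξ) = β * (ξ ⬝ᵥ (M *ᵥ g)) := by
    rw [dotProduct_transpose_mulVec_comm, hg, mulVec_smul, dotProduct_smul, smul_eq_mul,
      mul_inv_cancel_left₀ hβ.ne']
  have h5 : g ⬝ᵥ (Λ⁻¹ *ᵥ g) = β⁻¹ ^ 2 * (f ⬝ᵥ (Λ⁻¹ *ᵥ f)) := by
    rw [hg, mulVec_smul, smul_dotProduct, dotProduct_smul, smul_eq_mul, smul_eq_mul]
    ring
  have s1 := hRt.inv.posSemidef.quad_nonneg (y + Rt *ᵥ (Tᵀ *ᵥ z))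
  have s2 := hP.inv.posSemidef.quad_nonneg (ξ + P *ᵥ (η₀ + M *ᵥ g))
  have s3 := hK.posSemidef.quad_nonneg (v + (-K)⁻¹ *ᵥ (β • c))
  have hβ' := inv_pos.2 hβ
  -- A Schur complement in vector form: the Lagrangian at (x, w, g) plus three nonnegative squares.
  -- When the Lagrangian's argument is zero, the squares alone detect y, ξ and v.
  have key : x ⬝ᵥ (P *ᵥ x) - w ⬝ᵥ (Q *ᵥ w) - 2 * (w ⬝ᵥ (S *ᵥ z))
      + (y ⬝ᵥ (Rt⁻¹ *ᵥ y) + 2 * (y ⬝ᵥ (Tᵀ *ᵥ z))) + (ξ ⬝ᵥ (P⁻¹ *ᵥ ξ) + 2 * (ξ ⬝ᵥ η₀))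
      + (2 * (v ⬝ᵥ c) - β⁻¹ * (v ⬝ᵥ (K *ᵥ v)))
      + β⁻¹ * (f ⬝ᵥ (Λ⁻¹ *ᵥ f) + 2 * (f ⬝ᵥ (Mᵀ *ᵥ ξ))) =
      (dissForm P A B C D Q S (T * Rt * Tᵀ) M (x, w, g) + -β * uncForm Ex Ew K Λ (x, w, g))
      + (y + Rt *ᵥ (Tᵀ *ᵥ z)) ⬝ᵥ (Rt⁻¹ *ᵥ (y + Rt *ᵥ (Tᵀ *ᵥ z)))
      + (ξ + P *ᵥ (η₀ + M *ᵥ g)) ⬝ᵥ (P⁻¹ *ᵥ (ξ + P *ᵥ (η₀ + M *ᵥ g)))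
      + β⁻¹ * ((v + (-K)⁻¹ *ᵥ (β • c)) ⬝ᵥ ((-K) *ᵥ (v + (-K)⁻¹ *ᵥ (β • c)))) := by
    rw [hval, h4, h5, h1, ← hR]
    have h2' : ξ ⬝ᵥ (P⁻¹ *ᵥ ξ) = (ξ + P *ᵥ (η₀ + M *ᵥ g)) ⬝ᵥ (P⁻¹ *ᵥ (ξ + P *ᵥ (η₀ + M *ᵥ g)))
        - (η₀ + M *ᵥ g) ⬝ᵥ (P *ᵥ (η₀ + M *ᵥ g)) - 2 * (ξ ⬝ᵥ η₀ + ξ ⬝ᵥ (M *ᵥ g)) := by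
      rw [dotProduct_add] at h2
      linarith
    have h3' : (v + (-K)⁻¹ *ᵥ (β • c)) ⬝ᵥ ((-K) *ᵥ (v + (-K)⁻¹ *ᵥ (β • c))) =
        -(v ⬝ᵥ (K *ᵥ v)) + 2 * (β * (v ⬝ᵥ c)) + β ^ 2 * (c ⬝ᵥ ((-K)⁻¹ *ᵥ c)) := by
      have e : (β • c) ⬝ᵥ ((-K)⁻¹ *ᵥ (β • c)) = β ^ 2 * (c ⬝ᵥ ((-K)⁻¹ *ᵥ c)) := by
        rw [mulVec_smul, smul_dotProduct, dotProduct_smul, smul_eq_mul, smul_eq_mul]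
        ring
      rw [e, neg_mulVec, dotProduct_neg, dotProduct_smul, smul_eq_mul] at h3
      linarith
    rw [h2', h3']
    field_simp
    ring
  rw [key]
  have s3' := mul_nonneg hβ'.le s3
  by_cases h0 : ((x, w, g) : (ι → ℝ) × (Fin q → ℝ) × (Fin pt → ℝ)) = 0
  · obtain ⟨rfl, rfl, hg0⟩ : x = 0 ∧ w = 0 ∧ g = 0 := by simpa [Prod.ext_iff] using h0
    have hf0 : f = 0 := by simpa [hg, hβ.ne'] using hg0
    have hz0 : z = 0 := by simp [hz]
    have hc0 : c = 0 := by simp [hc]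
    have hη0 : η₀ = 0 := by simp [hη₀]
    have hv0 : dissForm P A B C D Q S (T * Rt * Tᵀ) M (0, 0, g)
        + -β * uncForm Ex Ew K Λ (0, 0, g) = 0 := by
      rw [hval]; simp [hz0, hc0, hη0, hg0]
    rw [hv0]
    simp only [hz0, hc0, hη0, hg0, mulVec_zero, smul_zero, add_zero, zero_add] at s1 s2 s3 s3' ⊢
    by_contra hn
    have e1 : y = 0 := hRt.inv.eq_zero_of_quad_nonpos (by linarith)
    have e2 : ξ = 0 := hP.inv.eq_zero_of_quad_nonpos (by linarith)
    have e3 : v = 0 := hK.eq_zero_of_quad_nonpos (by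
      by_contra! hlt
      have := mul_pos hβ' hlt
      linarith)
    apply hv
    rw [e1, e2, e3, hf0]
    ext ((i | i | i) | (i | i | i)) <;> rfl
  · have := h _ h0
    linarith

/-- The dissipation inequality of all uncertain systems implies the linearized inequality, also
for small perturbations of the certificate. -/
theorem exists_analysisMat_posDef [DecidableEq ι] [DecidableEq κ] (hP : P.PosDef)
    (hQ : Q.IsSymm) (hRt : Rt.PosDef) (hΛ : Λ.PosDef) (hK : (-K).PosDef)
    (h : ∀ Δ : Matrix (Fin p) κ ℝ, (Ξ * Λ * Ξᵀ + Δ * K * Δᵀ).PosSemidef →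
      ∀ (x : ι → ℝ) (w : Fin q → ℝ), ¬ (x = 0 ∧ w = 0) →
      0 < dissVal P Q S (T * Rt * Tᵀ) x ((A + M₁ * Δ * Ex) *ᵥ x + (B + M₁ * Δ * Ew) *ᵥ w) w
        (C *ᵥ x + D *ᵥ w))
    {J : Matrix ι ι ℝ} (hJ : J.IsSymm) :
    ∃ α : ℝ, ∃ δ > 0, ∀ ε : ℝ, |ε| < δ → (P + ε • J).PosDef ∧
      (analysisMat (P + ε • J) (P + ε • J)⁻¹ A B C D Q S T Rt Ex Ew (M₁ * Ξ) K Λ α).PosDef := by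
  have hq := isQuadratic_dissForm P A B C D Q S (T * Rt * Tᵀ) (M₁ * Ξ)
  have hu := isQuadratic_uncForm Ex Ew K Λ
  obtain ⟨β, hβ, hpos⟩ := strict_s_lemma hq hu (by
    rintro ⟨x, w, f⟩ hne hle
    simp only [uncForm] at hle
    obtain ⟨Δ, hΔ, hΔc⟩ := exists_uncertainty (p := p) (Ξ := Ξ) hΛ hK (Ex *ᵥ x + Ew *ᵥ w) f
      (by linarith)
    by_cases hxw : x = 0 ∧ w = 0
    · obtain ⟨rfl, rfl⟩ := hxw
      simp only [mulVec_zero, add_zero, dotProduct_zero, zero_sub] at hle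
      have : f = 0 := hΛ.inv.eq_zero_of_quad_nonpos (by linarith)
      exact absurd (by rw [this]; rfl) hne
    · have h1 := h Δ hΔ x w hxw
      have e : (A + M₁ * Δ * Ex) *ᵥ x + (B + M₁ * Δ * Ew) *ᵥ w =
          A *ᵥ x + B *ᵥ w + (M₁ * Ξ) *ᵥ f := by
        rw [← mulVec_mulVec, ← hΔc]
        simp only [add_mulVec, mulVec_add, ← mulVec_mulVec]
        abel
      rw [e] at h1
      exact h1)
  -- The constraint form does not involve P, so the same β serves all perturbed certificates.
  obtain ⟨δ₁, hδ₁, h₁⟩ := exists_perturbation (hq.add_mul hu (-β))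
    (isQuadratic_dissForm J A B C D 0 0 (0 : Matrix (Fin pz) (Fin pz) ℝ) (M₁ * Ξ)) hpos
  obtain ⟨δ₂, hδ₂, h₂⟩ := exists_perturbation
    (isQuadratic_dotProduct LinearMap.id P.mulVecLin)
    (isQuadratic_dotProduct LinearMap.id J.mulVecLin) (posDef_real_iff.1 hP).2
  refine ⟨β⁻¹, min δ₁ δ₂, lt_min hδ₁ hδ₂, fun ε hε => ?_⟩
  have hPε : (P + ε • J).PosDef := by
    refine posDef_real_iff.2 ⟨(posDef_real_iff.1 hP).1.add (hJ.smul ε), fun x hx => ?_⟩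
    have := h₂ ε (hε.trans_le (min_le_right _ _)) x hx
    simpa [add_mulVec, smul_mulVec, dotProduct_add] using this
  refine ⟨hPε, analysisMat_posDef_of_forms hPε hQ hRt hΛ hK hβ fun ζ hζ => ?_⟩
  have := h₁ ε (hε.trans_le (min_le_left _ _)) ζ hζ
  rw [dissForm_add_smul]
  linarith

end Robust

/-! ### Factorization and completing the square around the center -/

section Data

variable {κ : Type*} [Fintype κ]

theorem dotProduct_self_mulVec {ι : Type*} [Fintype ι] (B : Matrix ι κ ℝ) (K : Matrix κ κ ℝ)
    (s : ι → ℝ) : s ⬝ᵥ ((B * K * Bᵀ) *ᵥ s) = (Bᵀ *ᵥ s) ⬝ᵥ (K *ᵥ (Bᵀ *ᵥ s)) := by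
  rw [← mulVec_mulVec, ← mulVec_mulVec, dotProduct_mulVec, ← mulVec_transpose]

/-- A matrix that annihilates the left kernel of `B` factors through `B`. -/
theorem exists_mul_eq_of_vecMul_eq_zero {ι μ : Type*} [Fintype ι] [DecidableEq ι] [Fintype μ]
    [DecidableEq μ] (B : Matrix ι κ ℝ) (E : Matrix ι μ ℝ)
    (h : ∀ v : ι → ℝ, v ᵥ* B = 0 → v ᵥ* E = 0) : ∃ Ω : Matrix κ μ ℝ, E = B * Ω := by
  have hcol : ∀ j, E.col j ∈ LinearMap.range B.mulVecLin := by
    intro j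
    by_contra hj
    -- A column outside the range of B is separated from it by a functional, that is, by a left
    -- kernel vector v of B with v·E ≠ 0.
    obtain ⟨φ, h1, h2⟩ := Submodule.exists_le_ker_of_notMem hj
    set v : ι → ℝ := fun i => φ (Pi.single i 1) with hv
    have hφ : ∀ x : ι → ℝ, φ x = v ⬝ᵥ x := by
      intro x
      conv_lhs => rw [← Finset.univ_sum_single x]
      simp only [map_sum, dotProduct, hv]
      refine Finset.sum_congr rfl fun i _ => ?_
      rw [mul_comm, ← smul_eq_mul, ← map_smul, ← Pi.single_smul, smul_eq_mul, mul_one]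
    have h3 : v ᵥ* B = 0 := by
      classical
      ext k
      have : B.mulVecLin (Pi.single k 1) ∈ LinearMap.ker φ := h2 ⟨_, rfl⟩
      rw [LinearMap.mem_ker, hφ, mulVecLin_apply, dotProduct_mulVec] at this
      simpa using this
    apply h1
    rw [hφ]
    exact congrFun (h v h3) j
  choose ω hω using hcol
  refine ⟨Matrix.of fun k j => ω j k, ?_⟩
  ext i j
  have := congrFun (hω j) i
  simpa [mulVec, dotProduct, Matrix.mul_apply] using this.symm

variable {p : ℕ}

/-- The block row `(I Z)`. -/
abbrev oneCols (Z : Matrix (Fin p) κ ℝ) : Matrix (Fin p) (Fin p ⊕ κ) ℝ := fromCols 1 Z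

theorem oneCols_mul_mul_transpose (H : Matrix (Fin p ⊕ κ) (Fin p ⊕ κ) ℝ)
    (Z : Matrix (Fin p) κ ℝ) :
    oneCols Z * H * (oneCols Z)ᵀ =
      H.toBlocks₁₁ + Z * H.toBlocks₂₁ + H.toBlocks₁₂ * Zᵀ + Z * H.toBlocks₂₂ * Zᵀ := by
  conv_lhs => rw [← fromBlocks_toBlocks H]
  rw [fromCols_mul_fromBlocks, transpose_fromCols, fromCols_mul_fromRows]
  simp only [Matrix.one_mul, transpose_one, Matrix.mul_one, Matrix.add_mul]
  abel

variable [DecidableEq κ] {H : Matrix (Fin p ⊕ κ) (Fin p ⊕ κ) ℝ}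

theorem toBlocks₂₂_mul_centerT (hu : IsUnit H.toBlocks₂₂) :
    H.toBlocks₂₂ * centerT H = -H.toBlocks₂₁ := by
  rw [centerT, Matrix.mul_neg, ← Matrix.mul_assoc,
    mul_nonsing_inv _ ((isUnit_iff_isUnit_det _).1 hu), Matrix.one_mul]

/-- The center is defined to solve exactly this linear equation, so the H̄ entries of Π drop out. -/
theorem barHT_eq_zero (hu : IsUnit H.toBlocks₂₂) : barHT H = 0 := by
  have h : H.toRows₂ = fromCols H.toBlocks₂₁ H.toBlocks₂₂ := by
    ext i (j | j) <;> rfl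
  rw [barHT, colCenter, h, fromCols_mul_fromRows, Matrix.mul_one, toBlocks₂₂_mul_centerT hu,
    add_neg_cancel]

/-- Completing the square around the center. -/
theorem oneCols_mul_mul_transpose_eq (hH : H.IsSymm) (hu : IsUnit H.toBlocks₂₂)
    (Δ : Matrix (Fin p) κ ℝ) :
    oneCols ((centerT H)ᵀ + Δ) * H * (oneCols ((centerT H)ᵀ + Δ))ᵀ =
      (colCenter H)ᵀ * H * colCenter H + Δ * H.toBlocks₂₂ * Δᵀ := by
  have h12 : H.toBlocks₁₂ = H.toBlocks₂₁ᵀ := by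
    conv_lhs => rw [← hH.eq]
    rfl
  have h22 : H.toBlocks₂₂ᵀ = H.toBlocks₂₂ := by
    conv_rhs => rw [← hH.eq]
    rfl
  have h21 : H.toBlocks₂₁ = -(H.toBlocks₂₂ * centerT H) := by
    rw [toBlocks₂₂_mul_centerT hu, neg_neg]
  have hc : (colCenter H)ᵀ * H * colCenter H =
      oneCols (centerT H)ᵀ * H * (oneCols (centerT H)ᵀ)ᵀ := by
    rw [colCenter, transpose_fromCols, transpose_fromRows, transpose_one, transpose_transpose]
  rw [hc, oneCols_mul_mul_transpose, oneCols_mul_mul_transpose, h12, h21]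
  simp only [transpose_neg, transpose_mul, transpose_add, transpose_transpose, h22,
    Matrix.mul_add, Matrix.add_mul, Matrix.mul_neg, Matrix.neg_mul, Matrix.mul_assoc]
  abel

end Data

/-! ### The consistent set as a quadratic matrix inequality -/

section DataMatrices

variable {m q md N n p : ℕ} {Bd0 : Matrix (Fin p) (Fin md) ℝ}
    {Φ : Matrix (Fin md ⊕ Fin N) (Fin md ⊕ Fin N) ℝ}
    {Y : Matrix (Fin p) (Fin N) ℝ} {Xd : Matrix (Fin n) (Fin N) ℝ}
    {U : Matrix (Fin m) (Fin N) ℝ} {W : Matrix (Fin q) (Fin N) ℝ}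

theorem vecMul_injective_of_rank {ι κ : Type*} [Fintype ι] [Fintype κ] {G : Matrix ι κ ℝ}
    (h : G.rank = Fintype.card ι) : Function.Injective G.vecMul := by
  rw [vecMul_injective_iff]
  rw [rank_eq_finrank_span_row] at h
  exact linearIndependent_iff_card_eq_finrank_span.2 h.symm

theorem matH_isSymm (hΦ : Φ.IsSymm) : (matH Bd0 Φ Y Xd U W).IsSymm := by
  simp only [matH, IsSymm, transpose_mul, transpose_transpose, hΦ.eq, Matrix.mul_assoc]

/-- The zero block in F leaves 𝓗 = GΦ₂₂Gᵀ, and G has full row rank. -/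
theorem matH_toBlocks₂₂_neg (hΦ22 : (-Φ.toBlocks₂₂).PosDef)
    (hRank : (fromRows Xd (fromRows U W)).rank = n + m + q) :
    (-(matH Bd0 Φ Y Xd U W).toBlocks₂₂).PosDef := by
  have h : -(matH Bd0 Φ Y Xd U W).toBlocks₂₂ =
      fromRows Xd (fromRows U W) * (-Φ.toBlocks₂₂) * (fromRows Xd (fromRows U W))ᴴ := by
    rw [matH]
    conv_lhs => rw [← fromBlocks_toBlocks Φ]
    rw [fromBlocks_transpose, fromBlocks_multiply, fromBlocks_multiply, toBlocks_fromBlocks₂₂,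
      conjTranspose_eq_transpose_of_trivial]
    simp only [Matrix.zero_mul, zero_add, transpose_neg, Matrix.mul_neg, Matrix.neg_mul, neg_neg,
      transpose_zero, Matrix.mul_zero]
  rw [h]
  refine hΦ22.mul_mul_conjTranspose_same (vecMul_injective_of_rank ?_)
  simp [hRank, add_assoc]

/-- The consistent triples are the solutions of a quadratic matrix inequality. -/
theorem mem_consistentSet_iff (hΦ : Φ.IsSymm) (hΦ22 : (-Φ.toBlocks₂₂).PosDef)
    (hBd0 : Bd0.rank = md)
    (τ : Matrix (Fin p) (Fin n) ℝ × Matrix (Fin p) (Fin m) ℝ × Matrix (Fin p) (Fin q) ℝ) :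
    τ ∈ consistentSet Bd0 Φ Y Xd U W ↔
      (oneCols (fromCols τ.1 (fromCols τ.2.1 τ.2.2)) * matH Bd0 Φ Y Xd U W *
        (oneCols (fromCols τ.1 (fromCols τ.2.1 τ.2.2)))ᵀ).PosSemidef := by
  set Z := fromCols τ.1 (fromCols τ.2.1 τ.2.2) with hZ
  set E := Y - (τ.1 * Xd + τ.2.1 * U + τ.2.2 * W) with hE
  have hF : oneCols Z * fromBlocks Bd0 Y 0 (-fromRows Xd (fromRows U W)) =
      fromCols Bd0 E := by
    rw [fromCols_mul_fromBlocks, hZ]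
    simp only [Matrix.one_mul, Matrix.mul_zero, add_zero, Matrix.mul_neg, fromCols_mul_fromRows,
      hE, sub_eq_add_neg, add_assoc]
  have hH : oneCols Z * matH Bd0 Φ Y Xd U W * (oneCols Z)ᵀ =
      fromCols Bd0 E * Φ * (fromCols Bd0 E)ᵀ := by
    rw [← hF, matH, transpose_mul]
    simp only [Matrix.mul_assoc]
  have hΩ : ∀ Ω : Matrix (Fin md) (Fin N) ℝ,
      fromCols Bd0 (Bd0 * Ω) = Bd0 * (fromRows 1 Ωᵀ)ᵀ := fun Ω => by
    rw [transpose_fromRows, mul_fromCols, transpose_one, Matrix.mul_one, transpose_transpose]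
  rw [hH]
  constructor
  · rintro ⟨Ω, hN, hY⟩
    have hE' : E = Bd0 * Ω := by rw [hE, hY]; abel
    rw [hE', hΩ]
    have := hN.mul_mul_conjTranspose_same Bd0
    rw [conjTranspose_eq_transpose_of_trivial] at this
    simpa only [transpose_mul, transpose_transpose, Matrix.mul_assoc] using this
  · intro hpos
    -- On the left kernel of `Bd0` only the Φ₂₂ term survives. It is nonnegative by assumption and
    -- Φ₂₂ ≺ 0, so Eᵀv = 0.
    obtain ⟨Ω, hΩE⟩ := exists_mul_eq_of_vecMul_eq_zero Bd0 E (fun v hv => by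
      have h1 := hpos.quad_nonneg v
      rw [dotProduct_self_mulVec, transpose_fromCols, fromRows_mulVec, mulVec_transpose Bd0, hv,
        ← fromBlocks_toBlocks Φ, fromBlocks_mulVec, sumElim_dotProduct_sumElim] at h1
      rw [← mulVec_transpose]
      refine hΦ22.eq_zero_of_quad_nonpos ?_
      simp only [Sum.elim_comp_inl, Sum.elim_comp_inr, mulVec_zero, zero_dotProduct,
        zero_add] at h1
      rw [neg_mulVec, dotProduct_neg]
      linarith)
    refine ⟨Ω, ?_, ?_⟩
    · rw [hΩE, hΩ] at hpos
      -- Full column rank makes every vector of the form `Bd0ᵀ` s, which lets the outer factor be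
      -- cancelled from the inequality.
      have hinj : Function.Surjective Bd0ᵀ.mulVec := by
        have : LinearMap.range Bd0ᵀ.mulVecLin = ⊤ := by
          apply Submodule.eq_top_of_finrank_eq
          rw [← Matrix.rank, rank_transpose, hBd0]
          simp
        intro y
        exact LinearMap.range_eq_top.1 this y
      refine posSemidef_real_iff.2 ⟨?_, fun x => ?_⟩
      · simp only [IsSymm, transpose_mul, transpose_transpose, hΦ.eq, Matrix.mul_assoc]
      · obtain ⟨s, rfl⟩ := hinj x
        have := hpos.quad_nonneg s
        rw [← dotProduct_self_mulVec]
        simpa only [transpose_mul, transpose_transpose, Matrix.mul_assoc] using this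
    · rw [← hΩE, hE]; abel

end DataMatrices

/-! ### The inverse of L -/

section Kernel

variable {r p n : ℕ} {L1 : Matrix (Fin r) (Fin n) ℝ} {X : Matrix (Fin p) (Fin n) ℝ}

theorem isUnit_mul_transpose_of_rows {ι κ : Type*} [Fintype ι] [DecidableEq ι] [Fintype κ]
    {G : Matrix ι κ ℝ} (h : LinearIndependent ℝ G.row) : IsUnit (G * Gᵀ) := by
  have := PosDef.mul_conjTranspose_self G (vecMul_injective_iff.2 h)
  rw [conjTranspose_eq_transpose_of_trivial] at this
  exact this.isUnit

/-- The two row spaces are orthogonal complements, so each block inverts separately. The last block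
column Xᵀ shows that (0 M)L⁻ᵀ = MX, the only way L enters Π. -/
theorem rectInv_matL (hL1 : RowsBasisOfKer L1 X) (hX : LinearIndependent ℝ X.row) :
    rectInv (matL L1 X) = fromCols (L1ᵀ * (L1 * L1ᵀ)⁻¹) Xᵀ := by
  have hXL : X * L1ᵀ = 0 := by
    ext i j
    have hj : L1.row j ∈ LinearMap.ker X.mulVecLin := by
      rw [← hL1.2]; exact Submodule.subset_span ⟨j, rfl⟩
    exact congrFun (LinearMap.mem_ker.1 hj) i
  have hLX : L1 * Xᵀ = 0 := by
    rw [← transpose_transpose L1, ← transpose_mul, hXL, transpose_zero]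
  have h1 : matL L1 X * fromCols (L1ᵀ * (L1 * L1ᵀ)⁻¹) Xᵀ = 1 := by
    rw [matL, fromRows_mul_fromCols, ← Matrix.mul_assoc, hLX, Matrix.mul_assoc _ X Xᵀ,
      mul_nonsing_inv _ ((isUnit_iff_isUnit_det _).1 (isUnit_mul_transpose_of_rows hL1.1)),
      nonsing_inv_mul _ ((isUnit_iff_isUnit_det _).1 (isUnit_mul_transpose_of_rows hX)),
      Matrix.mul_assoc _ X, ← Matrix.mul_assoc X, hXL, Matrix.zero_mul, Matrix.mul_zero,
      fromBlocks_one]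
  refine rectInv_eq h1 ((mul_eq_one_comm_of_card_eq _ _ _ ?_).1 h1)
  have hr : Module.finrank ℝ (LinearMap.ker X.mulVecLin) = r := by
    rw [← hL1.2, finrank_span_eq_card hL1.1, Fintype.card_fin]
  have hp : Module.finrank ℝ (LinearMap.range X.mulVecLin) = p := by
    have := hX.rank_matrix
    rwa [Fintype.card_fin] at this
  have := LinearMap.finrank_range_add_finrank_ker X.mulVecLin
  rw [hr, hp] at this
  simp at this ⊢
  omega

end Kernel

/-! ### Uncertain closed loop and linearizing transformation -/

section ClosedLoop

variable {l p m q n pc pz pzt pt r : ℕ}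

/-- State matrix of the closed loop. -/
def closedA (A : Matrix (Fin n) (Fin n) ℝ) (B : Matrix (Fin n) (Fin m) ℝ)
    (C : Matrix (Fin pc) (Fin n) ℝ) (Ac : Matrix (Fin n) (Fin n) ℝ)
    (Bc : Matrix (Fin n) (Fin pc) ℝ) (Cc : Matrix (Fin m) (Fin n) ℝ)
    (Dc : Matrix (Fin m) (Fin pc) ℝ) : Matrix (Fin n ⊕ Fin n) (Fin n ⊕ Fin n) ℝ :=
  fromBlocks (A + B * Dc * C) (B * Cc) (Bc * C) Ac

/-- The input of the uncertainty as a function of the state of the closed loop. -/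
def uncX (C : Matrix (Fin pc) (Fin n) ℝ) (Cc : Matrix (Fin m) (Fin n) ℝ)
    (Dc : Matrix (Fin m) (Fin pc) ℝ) (q : ℕ) :
    Matrix (Fin n ⊕ (Fin m ⊕ Fin q)) (Fin n ⊕ Fin n) ℝ :=
  fromRows (fromCols 1 0) (fromRows (fromCols (Dc * C) Cc) (fromCols 0 0))

/-- The input of the uncertainty as a function of the disturbance. -/
def uncW (n m q : ℕ) : Matrix (Fin n ⊕ (Fin m ⊕ Fin q)) (Fin q) ℝ :=
  fromRows 0 (fromRows 0 1)

/-- Only the first p rows of the realization are unknown; hence the uncertainty acts through X_s1ᵀ.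
-/
theorem transpose_mul_fromRows_add (Xs : Matrix (StateIdx l p m q) (Fin n) ℝ) {μ : Type*}
    (As Δ : Matrix (Fin p) μ ℝ) (J : Matrix (RestIdx l p m q) μ ℝ) :
    Xsᵀ * fromRows (As + Δ) J = Xsᵀ * fromRows As J + Xs.toRows₁ᵀ * Δ := by
  have h : Xsᵀ = fromCols Xs.toRows₁ᵀ Xs.toRows₂ᵀ := by
    rw [← transpose_fromRows, fromRows_toRows]
  rw [h, fromCols_mul_fromRows, fromCols_mul_fromRows, Matrix.mul_add]
  abel

variable {Xs : Matrix (StateIdx l p m q) (Fin n) ℝ} {C : Matrix (Fin pc) (Fin n) ℝ}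
    {C1 : Matrix (Fin pz) (Fin n) ℝ}
    {E : Matrix (Fin pz) (Fin m) ℝ} {D1 : Matrix (Fin pz) (Fin q) ℝ}
    {Q : Matrix (Fin q) (Fin q) ℝ} {S : Matrix (Fin q) (Fin pz) ℝ}
    {T : Matrix (Fin pz) (Fin pzt) ℝ} {Rt : Matrix (Fin pzt) (Fin pzt) ℝ}
    {Ac : Matrix (Fin n) (Fin n) ℝ} {Bc : Matrix (Fin n) (Fin pc) ℝ}
    {Cc : Matrix (Fin m) (Fin n) ℝ} {Dc : Matrix (Fin m) (Fin pc) ℝ}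
    {H : Matrix (Fin p ⊕ (Fin n ⊕ (Fin m ⊕ Fin q))) (Fin p ⊕ (Fin n ⊕ (Fin m ⊕ Fin q))) ℝ}
    {Ξ : Matrix (Fin p) (Fin pt) ℝ} {Λ : Matrix (Fin pt) (Fin pt) ℝ}

theorem closedA_add (As Δ₁ : Matrix (Fin p) (Fin n) ℝ) (Bu Δ₂ : Matrix (Fin p) (Fin m) ℝ)
    (Δ₃ : Matrix (Fin p) (Fin q) ℝ) :
    closedA (redA Xs (As + Δ₁)) (redB Xs (Bu + Δ₂)) C Ac Bc Cc Dc =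
      closedA (redA Xs As) (redB Xs Bu) C Ac Bc Cc Dc +
        fromRows Xs.toRows₁ᵀ (0 : Matrix (Fin n) (Fin p) ℝ) * fromCols Δ₁ (fromCols Δ₂ Δ₃) *
          uncX C Cc Dc q := by
  simp only [closedA, uncX, redA, redB, transpose_mul_fromRows_add, fromRows_mul,
    Matrix.zero_mul, Matrix.mul_assoc, fromCols_mul_fromRows, mul_fromCols, Matrix.mul_one,
    Matrix.mul_zero, fromCols_zero, add_zero]
  ext (i | i) (j | j) <;> simp [Matrix.add_mul, Matrix.mul_assoc]
  ring

theorem closedB_add (Δ₁ : Matrix (Fin p) (Fin n) ℝ) (Δ₂ : Matrix (Fin p) (Fin m) ℝ)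
    (Bw Δ₃ : Matrix (Fin p) (Fin q) ℝ) :
    fromRows (redB1 Xs (Bw + Δ₃)) (0 : Matrix (Fin n) (Fin q) ℝ) =
      fromRows (redB1 Xs Bw) 0 +
        fromRows Xs.toRows₁ᵀ (0 : Matrix (Fin n) (Fin p) ℝ) * fromCols Δ₁ (fromCols Δ₂ Δ₃) *
          uncW n m q := by
  simp only [uncW, redB1, transpose_mul_fromRows_add, fromRows_mul,
    Matrix.zero_mul, Matrix.mul_assoc, fromCols_mul_fromRows, Matrix.mul_one,
    Matrix.mul_zero, zero_add]
  ext (i | i) j <;> simp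

/-- Robust dissipativity in terms of the deviation from the center of the consistent set. -/
theorem robustDissipative_iff (hQ : Q.IsSymm) (hRt : Rt.PosDef)
    {Sig : Set (Matrix (Fin p) (Fin n) ℝ × Matrix (Fin p) (Fin m) ℝ × Matrix (Fin p) (Fin q) ℝ)}
    {R : Matrix (Fin pz) (Fin pz) ℝ} (hR : R = T * Rt * Tᵀ)
    (hSig : ∀ Δ : Matrix (Fin p) (Fin n ⊕ (Fin m ⊕ Fin q)) ℝ,
      (checkAs H + Δ.toCols₁, checkBu0 H + Δ.toCols₂.toCols₁, checkBw0 H + Δ.toCols₂.toCols₂) ∈ Sig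
        ↔ (Ξ * Λ * Ξᵀ + Δ * H.toBlocks₂₂ * Δᵀ).PosSemidef)
    (P : Matrix (Fin n ⊕ Fin n) (Fin n ⊕ Fin n) ℝ) :
    RobustDissipative Xs Sig C C1 E D1 Q S R Ac Bc Cc Dc P ↔ P.PosDef ∧
      ∀ Δ : Matrix (Fin p) (Fin n ⊕ (Fin m ⊕ Fin q)) ℝ,
        (Ξ * Λ * Ξᵀ + Δ * H.toBlocks₂₂ * Δᵀ).PosSemidef →
        ∀ (x : Fin n ⊕ Fin n → ℝ) (w : Fin q → ℝ), ¬ (x = 0 ∧ w = 0) →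
        0 < dissVal P Q S (T * Rt * Tᵀ) x
          ((closedA (redA Xs (checkAs H)) (redB Xs (checkBu0 H)) C Ac Bc Cc Dc +
            fromRows Xs.toRows₁ᵀ (0 : Matrix (Fin n) (Fin p) ℝ) * Δ * uncX C Cc Dc q) *ᵥ x +
          (fromRows (redB1 Xs (checkBw0 H)) 0 +
            fromRows Xs.toRows₁ᵀ (0 : Matrix (Fin n) (Fin p) ℝ) * Δ * uncW n m q) *ᵥ w) w
          (fromCols (C1 + E * Dc * C) (E * Cc) *ᵥ x + D1 *ᵥ w) := by
  subst hR
  have hRs : (T * Rt * Tᵀ).IsSymm := by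
    simp [IsSymm, transpose_mul, (posDef_real_iff.1 hRt).1.eq, Matrix.mul_assoc]
  have hΔ : ∀ Δ : Matrix (Fin p) (Fin n ⊕ (Fin m ⊕ Fin q)) ℝ,
      Δ = fromCols Δ.toCols₁ (fromCols Δ.toCols₂.toCols₁ Δ.toCols₂.toCols₂) := fun Δ => by
    rw [fromCols_toCols, fromCols_toCols]
  refine and_congr_right fun hP => ⟨fun h Δ hpos => ?_, fun h τ hτ => ?_⟩
  · have := (dissipationIneq_iff (posDef_real_iff.1 hP).1 hQ hRs).1 (h _ ((hSig Δ).2 hpos))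
    rw [hΔ Δ, ← closedA_add, ← closedB_add]
    exact this
  · obtain ⟨Δ, rfl⟩ : ∃ Δ : Matrix (Fin p) (Fin n ⊕ (Fin m ⊕ Fin q)) ℝ, τ =
        (checkAs H + Δ.toCols₁, checkBu0 H + Δ.toCols₂.toCols₁,
          checkBw0 H + Δ.toCols₂.toCols₂) := by
      refine ⟨fromCols (τ.1 - checkAs H)
        (fromCols (τ.2.1 - checkBu0 H) (τ.2.2 - checkBw0 H)), ?_⟩
      simp
    have h1 := h Δ ((hSig Δ).1 hτ)
    rw [hΔ Δ, ← closedA_add, ← closedB_add] at h1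
    exact (dissipationIneq_iff (posDef_real_iff.1 hP).1 hQ hRs).2 h1

/-- The synthesis matrix is a congruence transform of the analysis matrix of the closed loop. -/
theorem matPi_eq_congr (hu : IsUnit H.toBlocks₂₂) {L1 : Matrix (Fin r) (Fin n) ℝ}
    (hL1 : RowsBasisOfKer L1 Xs.toRows₁) (hXs : LinearIndependent ℝ Xs.toRows₁.row)
    {X Y Act U VT : Matrix (Fin n) (Fin n) ℝ} {Bct : Matrix (Fin n) (Fin pc) ℝ}
    {Cct : Matrix (Fin m) (Fin n) ℝ} (hX : X.IsSymm)
    {P Pi : Matrix (Fin n ⊕ Fin n) (Fin n ⊕ Fin n) ℝ} {α : ℝ}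
    (hP : (fromBlocks 1 Y 0 VT)ᵀ * P * fromBlocks 1 Y 0 VT = fromBlocks X 1 1 Y)
    (hPi : (fromBlocks 1 X 0 Uᵀ)ᵀ * Pi * fromBlocks 1 X 0 Uᵀ = fromBlocks Y 1 1 X)
    (hB : Bct = X * redB Xs (checkBu0 H) * Dc + U * Bc)
    (hC : Cct = Dc * C * Y + Cc * VT)
    (hA : Act = X * (redA Xs (checkAs H) * Y + redB Xs (checkBu0 H) * Cct) + U * Bc * C * Y
      + U * Ac * VT) :
    matPi Xs H L1 Ξ Λ C C1 E D1 Q S T Rt α X Y Act Bct Cct Dc =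
      (fromBlocks (fromBlocks (fromBlocks 1 Y 0 VT) 0 0 1) 0 0
        (fromBlocks (fromBlocks 1 X 0 Uᵀ) 0 0 1))ᵀ *
      analysisMat P Pi (closedA (redA Xs (checkAs H)) (redB Xs (checkBu0 H)) C Ac Bc Cc Dc)
        (fromRows (redB1 Xs (checkBw0 H)) 0) (fromCols (C1 + E * Dc * C) (E * Cc)) D1 Q S T Rt
        (uncX C Cc Dc q) (uncW n m q) (fromRows Xs.toRows₁ᵀ (0 : Matrix (Fin n) (Fin p) ℝ) * Ξ)
        H.toBlocks₂₂ Λ α *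
      fromBlocks (fromBlocks (fromBlocks 1 Y 0 VT) 0 0 1) 0 0
        (fromBlocks (fromBlocks 1 X 0 Uᵀ) 0 0 1) := by
  rw [analysisMat_congr, hP, hPi]
  have hZ : (fromBlocks (1 : Matrix (Fin n) (Fin n) ℝ) X 0 Uᵀ)ᵀ = fromBlocks 1 0 X U := by
    rw [fromBlocks_transpose, transpose_one, transpose_zero, hX.eq, transpose_transpose]
  -- All products of controller matrices with X, Y, U and VT are absorbed into `Act`, `Bct` and
  -- `Cct`.
  have hA' : fromBlocks 1 0 X U *
      closedA (redA Xs (checkAs H)) (redB Xs (checkBu0 H)) C Ac Bc Cc Dc *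
      fromBlocks 1 Y 0 VT =
      fromBlocks (redA Xs (checkAs H) + redB Xs (checkBu0 H) * Dc * C)
        (redA Xs (checkAs H) * Y + redB Xs (checkBu0 H) * Cct)
        (X * redA Xs (checkAs H) + Bct * C) Act := by
    rw [closedA, fromBlocks_multiply, fromBlocks_multiply, hA, hB, hC]
    congr 1 <;> simp only [Matrix.one_mul, Matrix.zero_mul, Matrix.mul_one, Matrix.mul_zero,
      add_zero, Matrix.mul_add, Matrix.add_mul, Matrix.mul_assoc] <;> abel
  have hB' : fromBlocks 1 0 X U *
      fromRows (redB1 Xs (checkBw0 H)) (0 : Matrix (Fin n) (Fin q) ℝ) =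
      fromRows (redB1 Xs (checkBw0 H)) (X * redB1 Xs (checkBw0 H)) := by
    rw [fromBlocks_mul_fromRows]; simp
  have hC' : fromCols (C1 + E * Dc * C) (E * Cc) * fromBlocks 1 Y 0 VT =
      fromCols (C1 + E * Dc * C) (C1 * Y + E * Cct) := by
    rw [fromCols_mul_fromBlocks, hC]
    simp [Matrix.mul_add, Matrix.add_mul, Matrix.mul_assoc, add_assoc]
  have hE' : uncX C Cc Dc q * fromBlocks 1 Y 0 VT =
      fromRows (fromCols 1 Y) (fromRows (fromCols (Dc * C) Cct) (fromCols 0 0)) := by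
    simp [uncX, fromRows_mul, fromCols_mul_fromBlocks, hC]
  have hM' : fromBlocks 1 0 X U * (fromRows Xs.toRows₁ᵀ (0 : Matrix (Fin n) (Fin p) ℝ) * Ξ) =
      fromRows (Xs.toRows₁ᵀ * Ξ) (X * (Xs.toRows₁ᵀ * Ξ)) := by
    rw [fromRows_mul, fromBlocks_mul_fromRows]; simp
  have hF : fromCols (0 : Matrix (Fin pt) (Fin r) ℝ) (α • Ξᵀ) *
      (fromCols (L1ᵀ * (L1 * L1ᵀ)⁻¹) Xs.toRows₁ᵀ)ᵀ = α • (Xs.toRows₁ᵀ * Ξ)ᵀ := by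
    rw [transpose_fromCols, fromCols_mul_fromRows, Matrix.zero_mul, zero_add,
      transpose_transpose, transpose_mul, transpose_transpose, Matrix.smul_mul]
  have e₁ : fromRows (-(S * fromCols (C1 + E * Dc * C) (C1 * Y + E * Cct)))
      (Tᵀ * fromCols (C1 + E * Dc * C) (C1 * Y + E * Cct)) =
      fromBlocks (-(S * (C1 + E * Dc * C))) (-(S * (C1 * Y + E * Cct)))
        (Tᵀ * (C1 + E * Dc * C)) (Tᵀ * (C1 * Y + E * Cct)) := by
    rw [mul_fromCols, mul_fromCols, fromCols_neg, fromRows_fromCols_eq_fromBlocks]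
  have e₂ : fromCols (fromRows (redB1 Xs (checkBw0 H)) (X * redB1 Xs (checkBw0 H)))
      (0 : Matrix (Fin n ⊕ Fin n) (Fin pzt) ℝ) =
      fromBlocks (redB1 Xs (checkBw0 H)) 0 (X * redB1 Xs (checkBw0 H)) 0 := by
    ext (i | i) (j | j) <;> rfl
  have e₃ : fromCols (uncW n m q) (0 : Matrix _ (Fin pzt) ℝ) =
      fromRows (fromCols 0 0) (fromRows (fromCols 0 0) (fromCols 1 0)) := by
    ext (i | i | i) (j | j) <;> rfl
  have e₄ : fromRows (0 : Matrix (Fin n ⊕ (Fin m ⊕ Fin q)) (Fin n ⊕ Fin n) ℝ)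
      (α • (fromRows (Xs.toRows₁ᵀ * Ξ) (X * (Xs.toRows₁ᵀ * Ξ)))ᵀ) =
      fromBlocks 0 0 (α • (Xs.toRows₁ᵀ * Ξ)ᵀ) (α • (Xs.toRows₁ᵀ * Ξ)ᵀ * X) := by
    rw [transpose_fromRows, transpose_mul X, hX.eq]
    ext (i | i) (j | j) <;> simp
  rw [hZ, hA', hB', hC', hE', hM', matPi, matPi11, matPi12T, matPi22, analysisMat,
    barHT_eq_zero hu, rectInv_matL hL1 hXs, e₁, e₂, e₃, e₄]
  simp only [hF, smul_zero, neg_zero, fromCols_zero, Matrix.zero_mul]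

end ClosedLoop

/-! ### Certificates and their block factorizations -/

section Certificate

variable {n : ℕ} {X Y U VT : Matrix (Fin n) (Fin n) ℝ}
    {P : Matrix (Fin n ⊕ Fin n) (Fin n ⊕ Fin n) ℝ}

theorem isUnit_fromBlocks_one (hVT : IsUnit VT) :
    IsUnit (fromBlocks (1 : Matrix (Fin n) (Fin n) ℝ) Y 0 VT) :=
  isUnit_fromBlocks_zero₂₁.2 ⟨isUnit_one, hVT⟩

theorem isUnit_transform {κ κ' : Type*} [Fintype κ] [DecidableEq κ] [Fintype κ'] [DecidableEq κ']
    (hVT : IsUnit VT) (hU : IsUnit U) :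
    IsUnit (fromBlocks
      (fromBlocks (fromBlocks (1 : Matrix (Fin n) (Fin n) ℝ) Y 0 VT) 0 0 (1 : Matrix κ κ ℝ)) 0 0
      (fromBlocks (fromBlocks (1 : Matrix (Fin n) (Fin n) ℝ) X 0 Uᵀ) 0 0
        (1 : Matrix κ' κ' ℝ))) :=
  isUnit_fromBlocks_zero₂₁.2
    ⟨isUnit_fromBlocks_zero₂₁.2 ⟨isUnit_fromBlocks_one hVT, isUnit_one⟩,
      isUnit_fromBlocks_zero₂₁.2
        ⟨isUnit_fromBlocks_one ((isUnit_transpose _).2 hU), isUnit_one⟩⟩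

/-- The transformed inverse of the certificate. -/
theorem transform_inv_eq (hP : P.PosDef) (hX : X.IsSymm) (hY : Y.IsSymm) (hVT : IsUnit VT)
    (hUV : U * VT = 1 - X * Y)
    (hV : (fromBlocks 1 Y 0 VT)ᵀ * P * fromBlocks 1 Y 0 VT = fromBlocks X 1 1 Y) :
    (fromBlocks 1 X 0 Uᵀ)ᵀ * P⁻¹ * fromBlocks 1 X 0 Uᵀ = fromBlocks Y 1 1 X := by
  set V := fromBlocks (1 : Matrix (Fin n) (Fin n) ℝ) Y 0 VT with hVdef
  -- The second transform is P V J with J the block swap. Conjugating P⁻¹ by it therefore gives Vᵀ P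
  -- V with its blocks interchanged.
  set J : Matrix (Fin n ⊕ Fin n) (Fin n ⊕ Fin n) ℝ := fromBlocks 0 1 1 0 with hJ
  have hVu : IsUnit Vᵀ.det := by
    rw [det_transpose]
    exact (isUnit_iff_isUnit_det _).1 (isUnit_fromBlocks_one hVT)
  have hPu : IsUnit P.det := (isUnit_iff_isUnit_det _).1 hP.isUnit
  have hVU : VTᵀ * Uᵀ = 1 - Y * X := by
    rw [← transpose_mul, hUV, transpose_sub, transpose_mul, hX.eq, hY.eq, transpose_one]
  have h1 : Vᵀ * fromBlocks 1 X 0 Uᵀ = Vᵀ * (P * V * J) := by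
    rw [← Matrix.mul_assoc, ← Matrix.mul_assoc, hV, hVdef, hJ, fromBlocks_transpose,
      fromBlocks_multiply, fromBlocks_multiply, hY.eq]
    simp [hVU]
  have hZ : fromBlocks 1 X 0 Uᵀ = P * V * J := by
    have := congrArg (Vᵀ⁻¹ * ·) h1
    simpa only [nonsing_inv_mul_cancel_left _ _ hVu] using this
  have hJt : Jᵀ = J := by simp [hJ, fromBlocks_transpose]
  have hPs : Pᵀ = P := (posDef_real_iff.1 hP).1.eq
  rw [hZ, transpose_mul, transpose_mul, hJt, hPs]
  calc J * (Vᵀ * P) * P⁻¹ * (P * V * J) = J * (Vᵀ * P * V) * J := by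
        simp only [Matrix.mul_assoc, nonsing_inv_mul_cancel_left _ _ hPu]
    _ = fromBlocks Y 1 1 X := by
        rw [hV, hJ, fromBlocks_multiply, fromBlocks_multiply]; simp

/-- If v = XYv, the block matrix annihilates the lower part of its product with (-Yv, v) and also
the upper part, so v = 0. -/
theorem isUnit_one_sub_mul (h : (fromBlocks X 1 1 Y).PosDef) : IsUnit (1 - X * Y) := by
  rw [← mulVec_injective_iff_isUnit, ← coe_mulVecLin, ← LinearMap.ker_eq_bot,
    LinearMap.ker_eq_bot']
  intro v hv
  have hv' : v = X *ᵥ (Y *ᵥ v) := by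
    rw [mulVecLin_apply, sub_mulVec, one_mulVec, ← mulVec_mulVec] at hv
    exact sub_eq_zero.1 hv
  have h0 : Sum.elim (-(Y *ᵥ v)) v = 0 := by
    refine h.eq_zero_of_quad_nonpos (le_of_eq ?_)
    rw [fromBlocks_mulVec]
    simp only [Sum.elim_comp_inl, Sum.elim_comp_inr, mulVec_neg, one_mulVec, ← hv',
      neg_add_cancel, Sum.elim_zero_zero, dotProduct_zero]
  exact funext fun i => congrFun h0 (.inr i)

/-- Existence of a certificate with prescribed transforms. -/
theorem exists_certificate (h : (fromBlocks X 1 1 Y).PosDef) (hVT : IsUnit VT) :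
    ∃ P : Matrix (Fin n ⊕ Fin n) (Fin n ⊕ Fin n) ℝ, P.PosDef ∧
      (fromBlocks 1 Y 0 VT)ᵀ * P * fromBlocks 1 Y 0 VT = fromBlocks X 1 1 Y := by
  have hV := isUnit_fromBlocks_one (Y := Y) hVT
  set V := fromBlocks (1 : Matrix (Fin n) (Fin n) ℝ) Y 0 VT
  have hVd := (isUnit_iff_isUnit_det _).1 hV
  have e : Vᵀ * (V⁻¹ᵀ * fromBlocks X 1 1 Y * V⁻¹) * V = fromBlocks X 1 1 Y := by
    have h1 : Vᵀ * V⁻¹ᵀ = 1 := by rw [← transpose_mul, nonsing_inv_mul _ hVd, transpose_one]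
    rw [← Matrix.mul_assoc, ← Matrix.mul_assoc, h1, Matrix.one_mul,
      nonsing_inv_mul_cancel_right _ _ hVd]
  refine ⟨_, ?_, e⟩
  rw [← IsUnit.posDef_star_left_conjugate_iff hV, star_eq_conjTranspose,
    conjTranspose_eq_transpose_of_trivial, e]
  exact h

/-- The transforms of a certificate whose off-diagonal block is invertible. -/
theorem transform_of_certificate (hP : P.PosDef) (hU : IsUnit P.toBlocks₁₂) :
    P.toBlocks₁₁.IsSymm ∧ P⁻¹.toBlocks₁₁.IsSymm ∧ IsUnit P⁻¹.toBlocks₂₁ ∧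
    P.toBlocks₁₂ * P⁻¹.toBlocks₂₁ = 1 - P.toBlocks₁₁ * P⁻¹.toBlocks₁₁ ∧
    (fromBlocks 1 P⁻¹.toBlocks₁₁ 0 P⁻¹.toBlocks₂₁)ᵀ * P *
      fromBlocks 1 P⁻¹.toBlocks₁₁ 0 P⁻¹.toBlocks₂₁ =
      fromBlocks P.toBlocks₁₁ 1 1 P⁻¹.toBlocks₁₁ := by
  have hPs := (posDef_real_iff.1 hP).1
  have hPis := (posDef_real_iff.1 hP.inv).1
  have hmul : P * P⁻¹ = 1 := mul_nonsing_inv _ ((isUnit_iff_isUnit_det _).1 hP.isUnit)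
  set X := P.toBlocks₁₁ with hX
  set U := P.toBlocks₁₂ with hUdef
  set Y := P⁻¹.toBlocks₁₁ with hY
  set VT := P⁻¹.toBlocks₂₁ with hVT
  have hXs : X.IsSymm := congrArg toBlocks₁₁ hPs.eq
  have hYs : Y.IsSymm := congrArg toBlocks₁₁ hPis.eq
  have h21 : P.toBlocks₂₁ = Uᵀ := (congrArg toBlocks₂₁ hPs.eq).symm
  have hPb : P = fromBlocks X U Uᵀ P.toBlocks₂₂ := by rw [← h21, fromBlocks_toBlocks]
  have hb : P * P⁻¹ = fromBlocks P.toBlocks₁₁ P.toBlocks₁₂ P.toBlocks₂₁ P.toBlocks₂₂ *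
      fromBlocks P⁻¹.toBlocks₁₁ P⁻¹.toBlocks₁₂ P⁻¹.toBlocks₂₁ P⁻¹.toBlocks₂₂ := by
    rw [fromBlocks_toBlocks, fromBlocks_toBlocks]
  rw [hb, fromBlocks_multiply, ← fromBlocks_one, fromBlocks_inj, h21] at hmul
  obtain ⟨h1, -, h2, -⟩ := hmul
  -- The first block column of P P⁻¹ = 1 reads XY + U VT = 1 and UᵀY + P₂₂ VT = 0. If VT v = 0, the
  -- second gives Yv = 0, as U is invertible, and the first gives v = 0.
  have hVTu : IsUnit VT := by
    rw [← mulVec_injective_iff_isUnit, ← coe_mulVecLin, ← LinearMap.ker_eq_bot,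
      LinearMap.ker_eq_bot']
    intro v hv
    rw [mulVecLin_apply] at hv
    have h3 : Uᵀ *ᵥ (Y *ᵥ v) = 0 := by
      have := congrArg (· *ᵥ v) h2
      simpa only [add_mulVec, ← mulVec_mulVec, ← hVT, ← hY, hv, mulVec_zero, add_zero,
        zero_mulVec] using this
    have h4 : Y *ᵥ v = 0 := by
      have hUt : IsUnit Uᵀ := by rwa [isUnit_transpose]
      exact mulVec_injective_iff_isUnit.2 hUt (by rw [h3, mulVec_zero])
    have := congrArg (· *ᵥ v) h1
    simpa only [add_mulVec, ← mulVec_mulVec, ← hVT, ← hY, hv, h4, mulVec_zero, add_zero,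
      one_mulVec, eq_comm] using this
  have hUV : U * VT = 1 - X * Y := eq_sub_of_add_eq' h1
  refine ⟨hXs, hYs, hVTu, hUV, ?_⟩
  have hVU : VTᵀ * Uᵀ = 1 - Y * X := by
    rw [← transpose_mul, hUV, transpose_sub, transpose_mul, hXs.eq, hYs.eq, transpose_one]
  conv_lhs => rw [hPb]
  rw [Matrix.mul_assoc, fromBlocks_multiply, fromBlocks_transpose, fromBlocks_multiply]
  have h1' : X * Y + U * VT = 1 := h1
  have h2' : Uᵀ * Y + P.toBlocks₂₂ * VT = 0 := h2
  simp only [Matrix.mul_one, Matrix.mul_zero, add_zero, transpose_one, transpose_zero, h1', h2',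
    Matrix.one_mul, Matrix.zero_mul, hYs.eq, hVU]
  simp

/-- Only the finitely many eigenvalues of -A must be avoided. -/
theorem exists_isUnit_add_smul_one (A : Matrix (Fin n) (Fin n) ℝ) {δ : ℝ} (hδ : 0 < δ) :
    ∃ ε : ℝ, |ε| < δ ∧ IsUnit (A + ε • (1 : Matrix (Fin n) (Fin n) ℝ)) := by
  obtain ⟨ε, hε, hs⟩ := (Set.Ioo_infinite hδ).exists_notMem_finite (finite_real_spectrum (A := -A))
  refine ⟨ε, by rw [abs_of_pos hε.1]; exact hε.2, ?_⟩
  rw [spectrum.notMem_iff] at hs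
  convert hs using 1
  rw [Algebra.algebraMap_eq_smul_one, sub_neg_eq_add, add_comm]

end Certificate

end DDSynth

/-! ### The equivalence and the controller reconstruction -/

open DDSynth in
theorem theorem1 {l p m q md N n pc pz pzt pt r : ℕ} (hl : 1 ≤ l)
    -- the plant and one recorded trajectory, generated by the plant on the times `0, …, N-1`
    (M : ARModel p m q md) (hBd0 : M.Bd0.rank = md)
    (s : Signals p m q md) (hs : ∀ t : ℕ, t < N → M.HoldsAt l s t)
    -- the state stays in the column space of the data; first `p` rows of `X` independent
    (hStay : StateStaysInData M l N s)
    (hRows : LinearIndependent ℝ (dataX l N s).toRows₁.row)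
    -- the noise bound
    (Φ : Matrix (Fin md ⊕ Fin N) (Fin md ⊕ Fin N) ℝ) (hΦ : Φ.IsSymm)
    (hΦ22 : (-Φ.toBlocks₂₂).PosDef) (hNoise : NoiseBound Φ (dataD N s))
    -- compact SVD `X = X_s diag(σ) X_rᵀ` and `X_d = diag(σ) X_rᵀ`
    (Xs : Matrix (StateIdx l p m q) (Fin n) ℝ) (σ : Fin n → ℝ) (Xr : Matrix (Fin N) (Fin n) ℝ)
    (hSVD : IsCompactSVD (dataX l N s) Xs σ Xr)
    (Xd : Matrix (Fin n) (Fin N) ℝ) (hXd : Xd = Matrix.diagonal σ * Xrᵀ)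
    -- the set of consistent triples
    (Sig : Set (Matrix (Fin p) (Fin n) ℝ × Matrix (Fin p) (Fin m) ℝ × Matrix (Fin p) (Fin q) ℝ))
    (hSig : Sig = consistentSet M.Bd0 Φ (dataY N s) Xd (dataU N s) (dataW N s))
    (hNonempty : Sig.Nonempty)
    (hRank : (fromRows Xd (fromRows (dataU N s) (dataW N s))).rank = n + m + q)
    -- performance output, measured output, supply rate
    (C1h : Matrix (Fin pz) (StateIdx l p m q) ℝ) (E : Matrix (Fin pz) (Fin m) ℝ)
    (D1 : Matrix (Fin pz) (Fin q) ℝ) (Ch : Matrix (Fin pc) (StateIdx l p m q) ℝ)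
    (C1 : Matrix (Fin pz) (Fin n) ℝ) (hC1 : C1 = C1h * Xs)
    (C : Matrix (Fin pc) (Fin n) ℝ) (hC : C = Ch * Xs)
    (Q : Matrix (Fin q) (Fin q) ℝ) (hQ : Q.IsSymm) (S : Matrix (Fin q) (Fin pz) ℝ)
    (R : Matrix (Fin pz) (Fin pz) ℝ) (hR : R.PosSemidef)
    (T : Matrix (Fin pz) (Fin pzt) ℝ) (Rt : Matrix (Fin pzt) (Fin pzt) ℝ) (hRt : Rt.PosDef)
    (hRfac : R = T * Rt * Tᵀ)
    -- auxiliary matrices entering `Π`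
    (H : Matrix (Fin p ⊕ (Fin n ⊕ (Fin m ⊕ Fin q))) (Fin p ⊕ (Fin n ⊕ (Fin m ⊕ Fin q))) ℝ)
    (hH : H = matH M.Bd0 Φ (dataY N s) Xd (dataU N s) (dataW N s))
    (Ξ : Matrix (Fin p) (Fin pt) ℝ) (Λ : Matrix (Fin pt) (Fin pt) ℝ) (hΛ : Λ.PosDef)
    (hΞΛ : (colCenter H)ᵀ * H * colCenter H = Ξ * Λ * Ξᵀ)
    (L1 : Matrix (Fin r) (Fin n) ℝ) (hL1 : RowsBasisOfKer L1 Xs.toRows₁) :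
    -- the two statements are equivalent
    ((∃ (Ac : Matrix (Fin n) (Fin n) ℝ) (Bc : Matrix (Fin n) (Fin pc) ℝ)
        (Cc : Matrix (Fin m) (Fin n) ℝ) (Dc : Matrix (Fin m) (Fin pc) ℝ)
        (P : Matrix (Fin n ⊕ Fin n) (Fin n ⊕ Fin n) ℝ),
        RobustDissipative Xs Sig C C1 E D1 Q S R Ac Bc Cc Dc P) ↔
      (∃ (α : ℝ) (X Y Act : Matrix (Fin n) (Fin n) ℝ) (Bct : Matrix (Fin n) (Fin pc) ℝ)
        (Cct : Matrix (Fin m) (Fin n) ℝ) (Dc : Matrix (Fin m) (Fin pc) ℝ),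
        X.IsSymm ∧ Y.IsSymm ∧
        (matPi Xs H L1 Ξ Λ C C1 E D1 Q S T Rt α X Y Act Bct Cct Dc).PosDef)) ∧
    -- reconstruction of a controller from any solution and any invertible `U`
    (∀ (α : ℝ) (X Y Act : Matrix (Fin n) (Fin n) ℝ) (Bct : Matrix (Fin n) (Fin pc) ℝ)
      (Cct : Matrix (Fin m) (Fin n) ℝ) (Dc : Matrix (Fin m) (Fin pc) ℝ),
      X.IsSymm → Y.IsSymm →
      (matPi Xs H L1 Ξ Λ C C1 E D1 Q S T Rt α X Y Act Bct Cct Dc).PosDef →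
      ∀ U : Matrix (Fin n) (Fin n) ℝ, IsUnit U →
      ∀ (VT Ac : Matrix (Fin n) (Fin n) ℝ) (Bc : Matrix (Fin n) (Fin pc) ℝ)
        (Cc : Matrix (Fin m) (Fin n) ℝ),
        VT = U⁻¹ * (1 - X * Y) →
        Bc = U⁻¹ * (Bct - X * redB Xs (checkBu0 H) * Dc) →
        Cc = (Cct - Dc * C * Y) * VT⁻¹ →
        Ac = U⁻¹ * (Act - X * (redA Xs (checkAs H) * Y + redB Xs (checkBu0 H) * Cct)
            - U * Bc * C * Y) * VT⁻¹ →
        IsUnit VT ∧ ∃ P : Matrix (Fin n ⊕ Fin n) (Fin n ⊕ Fin n) ℝ,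
          RobustDissipative Xs Sig C C1 E D1 Q S R Ac Bc Cc Dc P) := by
  subst hSig hH
  set H := matH M.Bd0 Φ (dataY N s) Xd (dataU N s) (dataW N s) with hH
  have hHs : H.IsSymm := matH_isSymm hΦ
  have hK : (-H.toBlocks₂₂).PosDef := matH_toBlocks₂₂_neg hΦ22 hRank
  have hu : IsUnit H.toBlocks₂₂ := by simpa using hK.isUnit.neg
  -- The first p rows of X are X_s1 X_d, so a row dependency of X_s1 would pass to X.
  have hXs : LinearIndependent ℝ Xs.toRows₁.row := by
    have h1 : (dataX l N s).toRows₁ = Xs.toRows₁ * (Matrix.diagonal σ * Xrᵀ) := by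
      rw [hSVD.2.2.2, Matrix.mul_assoc]
      rfl
    rw [← vecMul_injective_iff] at hRows ⊢
    intro v v' hvv
    refine hRows ?_
    change v ᵥ* _ = v' ᵥ* _
    rw [h1, ← vecMul_vecMul v, ← vecMul_vecMul v']
    exact congrArg (· ᵥ* (Matrix.diagonal σ * Xrᵀ)) hvv
  have hSig : ∀ Δ : Matrix (Fin p) (Fin n ⊕ (Fin m ⊕ Fin q)) ℝ,
      (checkAs H + Δ.toCols₁, checkBu0 H + Δ.toCols₂.toCols₁, checkBw0 H + Δ.toCols₂.toCols₂) ∈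
        consistentSet M.Bd0 Φ (dataY N s) Xd (dataU N s) (dataW N s)
        ↔ (Ξ * Λ * Ξᵀ + Δ * H.toBlocks₂₂ * Δᵀ).PosSemidef := by
    intro Δ
    have hZ : fromCols (checkAs H + Δ.toCols₁) (fromCols (checkBu0 H + Δ.toCols₂.toCols₁)
        (checkBw0 H + Δ.toCols₂.toCols₂)) = (centerT H)ᵀ + Δ := by
      ext i (j | j | j) <;> rfl
    rw [mem_consistentSet_iff hΦ hΦ22 hBd0]
    dsimp only
    rw [hZ, ← hH, oneCols_mul_mul_transpose_eq hHs hu, hΞΛ]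
  have hrec : ∀ (α : ℝ) (X Y Act : Matrix (Fin n) (Fin n) ℝ) (Bct : Matrix (Fin n) (Fin pc) ℝ)
      (Cct : Matrix (Fin m) (Fin n) ℝ) (Dc : Matrix (Fin m) (Fin pc) ℝ),
      X.IsSymm → Y.IsSymm →
      (matPi Xs H L1 Ξ Λ C C1 E D1 Q S T Rt α X Y Act Bct Cct Dc).PosDef →
      ∀ U : Matrix (Fin n) (Fin n) ℝ, IsUnit U →
      ∀ (VT Ac : Matrix (Fin n) (Fin n) ℝ) (Bc : Matrix (Fin n) (Fin pc) ℝ)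
        (Cc : Matrix (Fin m) (Fin n) ℝ),
        VT = U⁻¹ * (1 - X * Y) →
        Bc = U⁻¹ * (Bct - X * redB Xs (checkBu0 H) * Dc) →
        Cc = (Cct - Dc * C * Y) * VT⁻¹ →
        Ac = U⁻¹ * (Act - X * (redA Xs (checkAs H) * Y + redB Xs (checkBu0 H) * Cct)
            - U * Bc * C * Y) * VT⁻¹ →
        IsUnit VT ∧ ∃ P : Matrix (Fin n ⊕ Fin n) (Fin n ⊕ Fin n) ℝ,
          RobustDissipative Xs (consistentSet M.Bd0 Φ (dataY N s) Xd (dataU N s) (dataW N s))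
            C C1 E D1 Q S R Ac Bc Cc Dc P := by
    intro α X Y Act Bct Cct Dc hX hY hpos U hU VT Ac Bc Cc hVT hBc hCc hAc
    have hUd := (isUnit_iff_isUnit_det _).1 hU
    have hXY : (fromBlocks X 1 1 Y).PosDef :=
      hpos.submatrix (e := fun i => Sum.inl (Sum.inl i))
        (Sum.inl_injective.comp Sum.inl_injective)
    have hVTu : IsUnit VT := by
      rw [hVT]
      exact ((isUnit_nonsing_inv_iff).2 hU).mul (isUnit_one_sub_mul hXY)
    have hVTd := (isUnit_iff_isUnit_det _).1 hVTu
    have hUV : U * VT = 1 - X * Y := by rw [hVT, mul_nonsing_inv_cancel_left _ _ hUd]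
    obtain ⟨P, hP, hPV⟩ := exists_certificate hXY hVTu
    refine ⟨hVTu, P, (robustDissipative_iff hQ hRt hRfac hSig P).2 ⟨hP, fun Δ hΔ => ?_⟩⟩
    refine dissVal_pos_of_analysisMat_posDef (α := α) hP hRt hΛ hK ?_ hΔ
    rw [matPi_eq_congr hu hL1 hXs hX hPV (transform_inv_eq hP hX hY hVTu hUV hPV)
      (Ac := Ac) (Bc := Bc) (Cc := Cc)
      (by rw [hBc, mul_nonsing_inv_cancel_left _ _ hUd]; abel)
      (by rw [hCc, nonsing_inv_mul_cancel_right _ _ hVTd]; abel)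
      (by rw [hAc, Matrix.mul_assoc U⁻¹, mul_nonsing_inv_cancel_left _ _ hUd,
            nonsing_inv_mul_cancel_right _ _ hVTd]; abel),
      ← conjTranspose_eq_transpose_of_trivial, ← star_eq_conjTranspose,
      IsUnit.posDef_star_left_conjugate_iff] at hpos
    · exact hpos
    · exact isUnit_transform hVTu hU
  refine ⟨⟨?_, ?_⟩, hrec⟩
  · rintro ⟨Ac, Bc, Cc, Dc, P, hrob⟩
    obtain ⟨hP, hdiss⟩ := (robustDissipative_iff hQ hRt hRfac hSig P).1 hrob
    -- The direction J shifts P₁₂ by a multiple of the identity, so a small ε makes that block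
    -- invertible.
    obtain ⟨α, δ, hδ, hε⟩ := exists_analysisMat_posDef hP hQ hRt hΛ hK hdiss
      (J := fromBlocks 0 1 1 0) (by simp [IsSymm, fromBlocks_transpose])
    obtain ⟨ε, hεδ, hunit⟩ := exists_isUnit_add_smul_one P.toBlocks₁₂ hδ
    obtain ⟨hP', hpos⟩ := hε ε hεδ
    set P' := P + ε • fromBlocks (0 : Matrix (Fin n) (Fin n) ℝ) 1 1
      (0 : Matrix (Fin n) (Fin n) ℝ) with hP'def
    have hU : IsUnit P'.toBlocks₁₂ := hunit
    obtain ⟨hX, hY, hVT, hUV, hPV⟩ := transform_of_certificate hP' hU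
    refine ⟨α, P'.toBlocks₁₁, P'⁻¹.toBlocks₁₁,
      P'.toBlocks₁₁ * (redA Xs (checkAs H) * P'⁻¹.toBlocks₁₁ + redB Xs (checkBu0 H) *
        (Dc * C * P'⁻¹.toBlocks₁₁ + Cc * P'⁻¹.toBlocks₂₁)) +
        P'.toBlocks₁₂ * Bc * C * P'⁻¹.toBlocks₁₁ + P'.toBlocks₁₂ * Ac * P'⁻¹.toBlocks₂₁,
      P'.toBlocks₁₁ * redB Xs (checkBu0 H) * Dc + P'.toBlocks₁₂ * Bc,
      Dc * C * P'⁻¹.toBlocks₁₁ + Cc * P'⁻¹.toBlocks₂₁, Dc, hX, hY, ?_⟩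
    rw [matPi_eq_congr hu hL1 hXs hX hPV (transform_inv_eq hP' hX hY hVT hUV hPV)
      (Ac := Ac) (Bc := Bc) (Cc := Cc) rfl rfl rfl, ← conjTranspose_eq_transpose_of_trivial,
      ← star_eq_conjTranspose, IsUnit.posDef_star_left_conjugate_iff]
    · exact hpos
    · exact isUnit_transform hVT hU
  · rintro ⟨α, X, Y, Act, Bct, Cct, Dc, hX, hY, hpos⟩
    -- Any invertible U would do; U = 1 is the simplest.
    obtain ⟨-, P, hP⟩ := hrec α X Y Act Bct Cct Dc hX hY hpos 1 isUnit_one _ _ _ _ rfl rfl rfl rfl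
    exact ⟨_, _, _, Dc, P, hP⟩
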